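/- Let $n\ge 1$, let $f\in\mathbb C[z_1^{\pm1},\dots,z_n^{\pm1}]$ be a Laurent polynomial, let $V^*=V^*(f)=\{z\in(\mathbb C^*)^n : f(z)=0\}$, and let $\gamma_f(z)=(z_1f_{z_1}(z):\dots:z_nf_{z_n}(z))\in\mathbb P^{n-1}$ be the logarithmic Gauss map, defined at the points $z\in V^*$ that are regular, i.e. at which some $f_{z_i}(z)\neq0$ (all points of $V^*$, if $V^*$ is smooth). Let $(z_0,y_0)$ be a point of the graph of $\gamma_f$, where $y_0=(y_1:\dots:y_n)$. Let $\varphi_{y_0}$ be the germ at $z_0$ of the restriction to $V^*$ of $\langle y,\log z\rangle=\sum_i y_i\log z_i$, for any choice of branches of $\log z_i$ near $z_0$. Choose any holomorphic local coordinates $x=(x_1,\dots,x_{n-1})$ of $V^*$ centred at $z_0$, so that $\mathcal O_{V^*,z_0}\cong\mathbb C\{x\}$, and let $Q_\varphi=\mathbb C\{x\}/(\partial\varphi_{y_0}/\partial x_1,\dots,\partial\varphi_{y_0}/\partial x_{n-1})$ be the Milnor algebra, with $\mathbf m_Q$ the image in $Q_\varphi$ of the maximal ideal of $\mathbb C\{x\}$.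 The fiber $\gamma_f^{-1}(y_0)$ is taken with its complex space structure at $z_0$, given in $\mathcal O_{\mathbb C^n,z_0}$ by the ideal generated by $f$ and the $2\times2$ minors $z_if_{z_i}y_j-z_jf_{z_j}y_i$. When $z_0$ is isolated in the fiber, the singular locus $\mathrm{Sing}(\gamma_f^{-1}(y_0))$ is given at $z_0$ by the Jacobian criterion: by the ideal generated by these equations and the $n\times n$ minors of their Jacobian matrix with respect to $z_1,\dots,z_n$. (a) Restriction of functions to $V^*$ induces an isomorphism of $\mathbb C$-algebras $\mathcal O_{\gamma_f^{-1}(y_0),z_0}\cong Q_\varphi$. (b) If $z_0$ is an isolated point of the fiber $\gamma_f^{-1}(y_0)$, then $\mathrm{Ann}(\mathbf m_Q)$, the socle of $Q_\varphi$, is the ideal generated by the class of the Hessian determinant $\det(\partial^2\varphi_{y_0}/\partial x_i\partial x_j)$, and restriction of functions to $V^*$ induces an isomorphism of $\mathbb C$-algebras $\mathcal O_{\mathrm{Sing}(\gamma_f^{-1}(y_0)),z_0}\cong Q_\varphi/\mathrm{Ann}(\mathbf m_Q)$. -/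

import Mathlib

open Filter Topology

noncomputable section

namespace LogGauss

/-! ### Germs of holomorphic functions -/

/-- The ring `𝓞_{ℂⁿ, p}` of germs at `p` of functions that are holomorphic near `p`. -/
def AnalyticGerm {n : ℕ} (p : Fin n → ℂ) : Subring (Germ (𝓝 p) ℂ) where
  carrier := {g | ∃ F : (Fin n → ℂ) → ℂ, AnalyticAt ℂ F p ∧ (F : Germ (𝓝 p) ℂ) = g}
  mul_mem' := by
    rintro _ _ ⟨F, hF, rfl⟩ ⟨G, hG, rfl⟩
    exact ⟨F * G, hF.mul hG, rfl⟩
  one_mem' := ⟨fun _ => 1, analyticAt_const, rfl⟩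
  add_mem' := by
    rintro _ _ ⟨F, hF, rfl⟩ ⟨G, hG, rfl⟩
    exact ⟨F + G, hF.add hG, rfl⟩
  zero_mem' := ⟨fun _ => 0, analyticAt_const, rfl⟩
  neg_mem' := by
    rintro _ ⟨F, hF, rfl⟩
    exact ⟨-F, hF.neg, rfl⟩

/-- The germ at `p` of a function that is holomorphic near `p`. -/
def germOf {n : ℕ} {p : Fin n → ℂ} (F : (Fin n → ℂ) → ℂ) (hF : AnalyticAt ℂ F p) :
    AnalyticGerm p :=
  ⟨(F : Germ (𝓝 p) ℂ), F, hF, rfl⟩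

/-- Constants as germs. -/
def constHom {n : ℕ} (p : Fin n → ℂ) : ℂ →+* AnalyticGerm p where
  toFun c := germOf (fun _ => c) analyticAt_const
  map_one' := rfl
  map_mul' _ _ := rfl
  map_zero' := rfl
  map_add' _ _ := rfl

instance {n : ℕ} (p : Fin n → ℂ) : Algebra ℂ (AnalyticGerm p) := (constHom p).toAlgebra

/-- The maximal ideal of `𝓞_{ℂⁿ, p}`: the germs that vanish at `p`. -/
def vanishingIdeal {n : ℕ} (p : Fin n → ℂ) : Ideal (AnalyticGerm p) :=
  RingHom.ker ((Germ.valueRingHom : Germ (𝓝 p) ℂ →+* ℂ).comp (AnalyticGerm p).subtype)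

/-- The partial derivative `∂F/∂zᵢ` at `z`. -/
def partialDeriv {n : ℕ} (i : Fin n) (F : (Fin n → ℂ) → ℂ) (z : Fin n → ℂ) : ℂ :=
  fderiv ℂ F z (Pi.single i 1)

/-- The partial derivative `∂/∂zᵢ` on germs of holomorphic functions. -/
def pderiv {n : ℕ} {p : Fin n → ℂ} (i : Fin n) (g : AnalyticGerm p) : AnalyticGerm p :=
  ⟨Germ.map' (partialDeriv i)
      (fun F G h => (h.fderiv (𝕜 := ℂ)).mono fun z hz =>
        show fderiv ℂ F z (Pi.single i 1) = fderiv ℂ G z (Pi.single i 1) by rw [hz]) g.1, by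
    obtain ⟨_, F, hF, rfl⟩ := g
    exact ⟨partialDeriv i F,
      ((ContinuousLinearMap.apply ℂ ℂ (Pi.single i (1 : ℂ) : Fin n → ℂ)).analyticAt _).comp
        hF.fderiv, rfl⟩⟩

/-- The coordinate function `zᵢ` as a germ at `p`. -/
def coord {n : ℕ} (p : Fin n → ℂ) (i : Fin n) : AnalyticGerm p :=
  germOf (fun z => z i) ((ContinuousLinearMap.proj (R := ℂ) (φ := fun _ : Fin n => ℂ) i).analyticAt p)

/-! ### Milnor algebras -/

/-- The ideal `(∂h/∂x₁, …, ∂h/∂xₙ)`. -/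
def gradIdeal {n : ℕ} {p : Fin n → ℂ} (h : AnalyticGerm p) : Ideal (AnalyticGerm p) :=
  Ideal.span (Set.range fun i => pderiv i h)

/-- The Milnor algebra `Q_h = 𝓞 / (∂h/∂x₁, …, ∂h/∂xₙ)`. -/
abbrev MilnorAlgebra {n : ℕ} {p : Fin n → ℂ} (h : AnalyticGerm p) : Type :=
  AnalyticGerm p ⧸ gradIdeal h

/-- The ideal `𝔪_Q` of the Milnor algebra `Q`, the image of the maximal ideal of `𝓞`. -/
def milnorMaxIdeal {n : ℕ} {p : Fin n → ℂ} (h : AnalyticGerm p) : Ideal (MilnorAlgebra h) :=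
  (vanishingIdeal p).map (Ideal.Quotient.mk (gradIdeal h))

/-- The ideal `Ann(𝔪_Q)`, the socle of the Milnor algebra. -/
def milnorSocle {n : ℕ} {p : Fin n → ℂ} (h : AnalyticGerm p) : Ideal (MilnorAlgebra h) :=
  Submodule.annihilator (milnorMaxIdeal h)

/-- The Hessian determinant of a germ. -/
def hessian {n : ℕ} {p : Fin n → ℂ} (h : AnalyticGerm p) : AnalyticGerm p :=
  (Matrix.of fun i j => pderiv i (pderiv j h)).det

/-- The ideal of the singular locus of a zero-dimensional complex space germ in `(ℂⁿ, p)` given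
by the equations `F k`, `k : ι`: it is generated by the equations and by the `n × n` minors of
their Jacobian matrix (Jacobian criterion; modulo the equations this is the zeroth Fitting ideal
of the module of differentials). -/
def singularIdeal {n : ℕ} {p : Fin n → ℂ} {ι : Type} (F : ι → AnalyticGerm p) :
    Ideal (AnalyticGerm p) :=
  Ideal.span (Set.range F) ⊔
    Ideal.span (Set.range fun r : Fin n → ι => (Matrix.of fun i j => pderiv j (F (r i))).det)

/-! ### The toric hypersurface and its logarithmic Gauss map -/

/-- Laurent polynomials in `n` variables with complex coefficients. -/
abbrev LaurentPoly (n : ℕ) : Type := AddMonoidAlgebra ℂ (Fin n → ℤ)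

/-- The value of a Laurent polynomial at a point. -/
def LaurentPoly.eval {n : ℕ} (f : LaurentPoly n) (z : Fin n → ℂ) : ℂ :=
  f.coeff.sum fun α c => c * ∏ i, z i ^ α i

/-- The hypersurface `V*(f)` in the complex torus. -/
def toricHypersurface {n : ℕ} (f : LaurentPoly n) : Set (Fin n → ℂ) :=
  {z | (∀ i, z i ≠ 0) ∧ f.eval z = 0}

/-- The regular points of `V*(f)`: the points at which some `∂f/∂zᵢ` is nonzero. -/
def regularLocus {n : ℕ} (f : LaurentPoly n) : Set (Fin n → ℂ) :=
  {z | z ∈ toricHypersurface f ∧ ∃ i, partialDeriv i f.eval z ≠ 0}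

/-- The logarithmic Gauss map `z ↦ (z₁ ∂f/∂z₁ : … : zₙ ∂f/∂zₙ)`. -/
def logGauss {n : ℕ} (f : LaurentPoly n) (z : regularLocus f) :
    Projectivization ℂ (Fin n → ℂ) :=
  Projectivization.mk ℂ (fun i => z.1 i * partialDeriv i f.eval z.1) (by
    obtain ⟨i, hi⟩ := z.2.2
    exact fun h => mul_ne_zero (z.2.1.1 i) hi (congrFun h i))

theorem LaurentPoly.analyticAt_eval {n : ℕ} (f : LaurentPoly n) {z : Fin n → ℂ}
    (hz : ∀ i, z i ≠ 0) : AnalyticAt ℂ f.eval z := by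
  have h : f.eval = fun w => ∑ α ∈ f.coeff.support, f.coeff α * ∏ i, w i ^ α i := rfl
  rw [h]
  refine Finset.analyticAt_fun_sum _ fun α _ => analyticAt_const.mul ?_
  refine Finset.analyticAt_fun_prod _ fun i _ => ?_
  exact ((ContinuousLinearMap.proj (R := ℂ) (φ := fun _ : Fin n => ℂ) i).analyticAt z).zpow (hz i)

/-- The germ of `f` at a regular point of `V*(f)`. -/
def polyGerm {n : ℕ} (f : LaurentPoly n) (z₀ : regularLocus f) : AnalyticGerm z₀.1 :=
  germOf f.eval (f.analyticAt_eval z₀.2.1.1)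

/-- Equations of the fibre of the logarithmic Gauss map over `(y₁ : … : yₙ)` at `z₀`: the
function `f` and the `2 × 2` minors of the matrix with the rows `(z₁ f_{z₁}, …, zₙ f_{zₙ})` and
`(y₁, …, yₙ)`. -/
def fiberEq {n : ℕ} (f : LaurentPoly n) (y : Fin n → ℂ) (z₀ : regularLocus f) :
    Option (Fin n × Fin n) → AnalyticGerm z₀.1
  | none => polyGerm f z₀
  | some (i, j) =>
      coord z₀.1 i * pderiv i (polyGerm f z₀) * algebraMap ℂ (AnalyticGerm z₀.1) (y j) -
        coord z₀.1 j * pderiv j (polyGerm f z₀) * algebraMap ℂ (AnalyticGerm z₀.1) (y i)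

/-- The local ring at `z₀` of the fibre of the logarithmic Gauss map over `(y₁ : … : yₙ)`. -/
abbrev FiberRing {n : ℕ} (f : LaurentPoly n) (y : Fin n → ℂ) (z₀ : regularLocus f) : Type :=
  AnalyticGerm z₀.1 ⧸ Ideal.span (Set.range (fiberEq f y z₀))

/-- The local ring at `z₀` of the singular locus of the fibre of the logarithmic Gauss map. -/
abbrev FiberSingRing {n : ℕ} (f : LaurentPoly n) (y : Fin n → ℂ) (z₀ : regularLocus f) : Type :=
  AnalyticGerm z₀.1 ⧸ singularIdeal (fiberEq f y z₀)

/-! ### Local coordinates and the phase function -/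

/-- Local coordinates of `V*(f)` at the regular point `z₀`, given by the parametrization
`x ↦ z(x)` with `z(0) = z₀`: a holomorphic immersion germ from `ℂᵐ` to the
`m`-dimensional complex manifold germ `(V*(f), z₀)`. -/
structure LocalCoords {m : ℕ} (f : LaurentPoly (m + 1)) (z₀ : regularLocus f) where
  /-- The parametrization. -/
  param : (Fin m → ℂ) → (Fin (m + 1) → ℂ)
  param_zero : param 0 = z₀.1
  analyticAt : AnalyticAt ℂ param 0
  eventually_mem : ∀ᶠ x in 𝓝 0, param x ∈ toricHypersurface f
  immersion : Function.Injective (fderiv ℂ param 0)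

theorem LocalCoords.tendsto {m : ℕ} {f : LaurentPoly (m + 1)} {z₀ : regularLocus f}
    (ψ : LocalCoords f z₀) : Tendsto ψ.param (𝓝 0) (𝓝 z₀.1) := by
  have h := ψ.analyticAt.continuousAt.tendsto
  rwa [ψ.param_zero] at h

/-- Restriction of a function germ at `z₀` to `V*(f)`, written in the local coordinates. -/
def LocalCoords.restrict {m : ℕ} {f : LaurentPoly (m + 1)} {z₀ : regularLocus f}
    (ψ : LocalCoords f z₀) : AnalyticGerm z₀.1 →ₐ[ℂ] AnalyticGerm (0 : Fin m → ℂ) where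
  toFun g := ⟨g.1.compTendsto ψ.param ψ.tendsto, by
    obtain ⟨_, F, hF, rfl⟩ := g
    exact ⟨F ∘ ψ.param, AnalyticAt.comp (by rwa [ψ.param_zero]) ψ.analyticAt, rfl⟩⟩
  map_one' := rfl
  map_mul' := by
    rintro ⟨_, F, hF, rfl⟩ ⟨_, G, hG, rfl⟩
    rfl
  map_zero' := rfl
  map_add' := by
    rintro ⟨_, F, hF, rfl⟩ ⟨_, G, hG, rfl⟩
    rfl
  commutes' _ := rfl

/-- A branch of `log : (z₁, …, zₙ) ↦ (log z₁, …, log zₙ)` near the point `z₀`. -/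
structure LogBranch {n : ℕ} (z₀ : Fin n → ℂ) where
  /-- The branch of the logarithm in the `i`-th coordinate. -/
  log : Fin n → ℂ → ℂ
  analyticAt : ∀ i, AnalyticAt ℂ (log i) (z₀ i)
  exp_log : ∀ i, ∀ᶠ w in 𝓝 (z₀ i), Complex.exp (log i w) = w

/-- The germ at `z₀` of the function `z ↦ ⟨y, log z⟩ = y₁ log z₁ + … + yₙ log zₙ`. -/
def logForm {n : ℕ} (y : Fin n → ℂ) {z₀ : Fin n → ℂ} (L : LogBranch z₀) : AnalyticGerm z₀ :=
  germOf (fun z => ∑ i, y i * L.log i (z i)) (by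
    refine Finset.analyticAt_fun_sum _ fun i _ => analyticAt_const.mul ?_
    exact AnalyticAt.fun_comp (L.analyticAt i)
      ((ContinuousLinearMap.proj (R := ℂ) (φ := fun _ : Fin n => ℂ) i).analyticAt z₀))

/-- The germ at `z₀` of the phase function `φ_y`, the restriction of `⟨y, log z⟩` to `V*(f)`,
in local coordinates. -/
def phase {m : ℕ} {f : LaurentPoly (m + 1)} {z₀ : regularLocus f} (y : Fin (m + 1) → ℂ)
    (L : LogBranch z₀.1) (ψ : LocalCoords f z₀) : AnalyticGerm (0 : Fin m → ℂ) :=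
  ψ.restrict (logForm y L)

/-- Branches of the logarithm exist at every point of the torus. -/
theorem LogBranch.nonempty {n : ℕ} {z₀ : Fin n → ℂ} (hz : ∀ i, z₀ i ≠ 0) :
    Nonempty (LogBranch z₀) := by
  refine ⟨⟨fun i w => Complex.log (w / z₀ i) + Complex.log (z₀ i), fun i => ?_, fun i => ?_⟩⟩
  · refine AnalyticAt.add (AnalyticAt.clog (analyticAt_id.div_const) ?_) analyticAt_const
    simp [hz i]
  · filter_upwards [isOpen_ne.mem_nhds (hz i)] with w hw
    have hw : w ≠ 0 := hw
    rw [Complex.exp_add, Complex.exp_log (div_ne_zero hw (hz i)), Complex.exp_log (hz i),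
      div_mul_cancel₀ _ (hz i)]

/-- Local coordinates exist at every regular point. -/
theorem LocalCoords.nonempty {m : ℕ} (f : LaurentPoly (m + 1)) (z₀ : regularLocus f) :
    Nonempty (LocalCoords f z₀) := by
  obtain ⟨z, hz, j, hj⟩ := z₀
  have hf : AnalyticAt ℂ f.eval z := f.analyticAt_eval hz.1
  let P : (Fin (m + 1) → ℂ) →L[ℂ] (Fin m → ℂ) :=
    ContinuousLinearMap.pi fun i => ContinuousLinearMap.proj (j.succAbove i)
  let Φ : (Fin (m + 1) → ℂ) → ℂ × (Fin m → ℂ) := fun w => (f.eval w, P w)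
  have hΦa : AnalyticAt ℂ Φ z := hf.prod (P.analyticAt z)
  let A : (Fin (m + 1) → ℂ) →L[ℂ] ℂ × (Fin m → ℂ) := (fderiv ℂ f.eval z).prod P
  have hinj : Function.Injective A := by
    rw [injective_iff_map_eq_zero]
    intro v hv
    have h1 : fderiv ℂ f.eval z v = 0 := congrArg Prod.fst hv
    have h2 : ∀ i, v (j.succAbove i) = 0 := fun i => congrFun (congrArg Prod.snd hv) i
    have h3 : v = v j • Pi.single j 1 := by
      funext k
      rcases Fin.eq_self_or_eq_succAbove j k with rfl | ⟨i, rfl⟩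
      · simp
      · simp [h2]
    rw [h3, map_smul] at h1
    have : v j = 0 := by
      rcases mul_eq_zero.1 h1 with h | h
      · exact h
      · exact absurd h hj
    rw [h3, this, zero_smul]
  let e : (Fin (m + 1) → ℂ) ≃L[ℂ] ℂ × (Fin m → ℂ) :=
    (LinearEquiv.ofInjectiveOfFinrankEq A.toLinearMap hinj (by simp [add_comm])).toContinuousLinearEquiv
  have he : (e : (Fin (m + 1) → ℂ) →L[ℂ] ℂ × (Fin m → ℂ)) = A := by
    ext v <;> rfl
  have hd : HasStrictFDerivAt Φ (e : (Fin (m + 1) → ℂ) →L[ℂ] ℂ × (Fin m → ℂ)) z := by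
    rw [he]
    exact hf.hasStrictFDerivAt.prodMk P.hasStrictFDerivAt
  let H := hd.toOpenPartialHomeomorph Φ
  have hHz : z ∈ H.source := hd.mem_toOpenPartialHomeomorph_source
  have hS : AnalyticAt ℂ H.symm (Φ z) :=
    H.analyticAt_symm' hHz hΦa hd.hasFDerivAt.fderiv
  have hSd : HasFDerivAt H.symm (e.symm : ℂ × (Fin m → ℂ) →L[ℂ] (Fin (m + 1) → ℂ)) (Φ z) :=
    hd.to_localInverse.hasFDerivAt
  have hΦz : Φ z = (0, P z) := Prod.ext hz.2 rfl
  let B : (Fin m → ℂ) → ℂ × (Fin m → ℂ) := fun x => (0, P z + x)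
  have hB0 : B 0 = Φ z := by simp [B, hΦz]
  have hBa : AnalyticAt ℂ B 0 := analyticAt_const.prod (analyticAt_const.add analyticAt_id)
  have hBd : HasFDerivAt B (ContinuousLinearMap.inr ℂ ℂ (Fin m → ℂ)) 0 :=
    (hasFDerivAt_const _ _).prodMk ((hasFDerivAt_id _).const_add _)
  have hψ0 : (H.symm ∘ B) 0 = z := by
    simp only [Function.comp, hB0]
    exact H.left_inv hHz
  have hψa : AnalyticAt ℂ (H.symm ∘ B) 0 := AnalyticAt.comp (by rwa [hB0]) hBa
  refine ⟨⟨H.symm ∘ B, hψ0, hψa, ?_, ?_⟩⟩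
  · have hc := hψa.continuousAt.tendsto
    rw [hψ0] at hc
    have h1 : ∀ᶠ w in 𝓝 z, ∀ i, w i ≠ 0 := eventually_all.2 fun i =>
      (continuous_apply i).continuousAt.eventually_ne (hz.1 i)
    have ht : H.target ∈ 𝓝 (B 0) := by
      rw [hB0]
      exact H.open_target.mem_nhds (H.map_source hHz)
    filter_upwards [hc.eventually h1, hBa.continuousAt.eventually ht] with x hx hx'
    refine ⟨hx, ?_⟩
    exact congrArg Prod.fst (H.right_inv hx')
  · rw [← hB0] at hSd
    rw [(hSd.comp 0 hBd).fderiv]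
    intro a b hab
    have := e.symm.injective hab
    exact congrArg Prod.snd this

end LogGauss

end

/-! Near a regular point, restriction to `V*` is a surjection of germ rings with kernel `(f)`
(`restrict_surjective`, `ker_restrict_le`), so everything is computed in the coordinates `x`. Let
`w_j` be the restriction of `z_j ∂f/∂z_j` and `t_jk = ∂ log z_j/∂x_k`. Differentiating `f = 0` along
`V*` gives `∑ w_j t_jk = 0`, while `∑ y_j t_jk = ∂φ/∂x_k`. Hence `w_i ∂φ/∂x_k` is a combination of
the minors `w_i y_j - w_j y_i`. Conversely, if `w_{i₀}` is a unit, the block of `t` without row `i₀`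
is invertible, and the minors are combinations of the `∂φ/∂x_k`. So the fibre equations restrict to
generators of the gradient ideal, which is (a).

For the singular locus, let the restrictions of `m + 1` chosen equations be `C ∇φ`. Their Jacobian
matrix, multiplied by an invertible matrix made of the tangent vectors and one transversal
direction, equals `(u | C) · diag(1, Hess φ)` modulo the gradient ideal. All maximal minors are thus
multiples of the Hessian determinant, and for `f` together with the minors of row `i₀` the factor is
a unit (`map_restrict_singularIdeal`).

It remains to see that the Jacobian determinant `J` generates the socle of a finite-dimensional
complete intersection `Q` (`mem_socle_iff_mem_sup_jacobian`). The Bezoutian in `Q ⊗ Q` produces a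
linear form `η` with nondegenerate pairing `η(ab)` such that multiplication by `h` has trace `η(hJ)`
(`socle_eq_span_jacobian`). Nilpotents have trace zero, so `J` lies in the socle; `η(J) = dim Q ≠ 0`
then gives generation. Nondegeneracy rests on `det_notMem_span`, a computation with Taylor
coefficients.

Finite dimension comes from isolatedness through a Nullstellensatz
(`vanishingIdeal_le_radical_span`), proved by eliminating one variable at a time with resultants
after Weierstrass division. Weierstrass division is obtained by inverting an operator close to the
identity on a Banach space of power series. -/

noncomputable section

namespace LogGauss

/-! ### Calculus of germs -/

section Germs

variable {n : ℕ} {p : Fin n → ℂ}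

/-- The germ `g` is the germ of the function `F`. -/
def IsGermOf (g : AnalyticGerm p) (F : (Fin n → ℂ) → ℂ) : Prop :=
  (g : Germ (𝓝 p) ℂ) = (F : Germ (𝓝 p) ℂ)

theorem isGermOf_germOf {F : (Fin n → ℂ) → ℂ} (hF : AnalyticAt ℂ F p) :
    IsGermOf (germOf F hF) F := rfl

theorem exists_isGermOf (g : AnalyticGerm p) : ∃ F, AnalyticAt ℂ F p ∧ IsGermOf g F := by
  obtain ⟨_, F, hF, rfl⟩ := g
  exact ⟨F, hF, rfl⟩

namespace IsGermOf

variable {g h : AnalyticGerm p} {F G : (Fin n → ℂ) → ℂ}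

theorem analyticAt (hg : IsGermOf g F) : AnalyticAt ℂ F p := by
  obtain ⟨_, F', hF', rfl⟩ := g
  exact hF'.congr (Germ.coe_eq.1 hg)

theorem eq_iff (hg : IsGermOf g F) (hh : IsGermOf h G) : g = h ↔ F =ᶠ[𝓝 p] G := by
  rw [← Germ.coe_eq, ← hg, ← hh]
  exact Subtype.ext_iff

theorem add (hg : IsGermOf g F) (hh : IsGermOf h G) : IsGermOf (g + h) fun z => F z + G z :=
  congrArg₂ (· + ·) hg hh

theorem sub (hg : IsGermOf g F) (hh : IsGermOf h G) : IsGermOf (g - h) fun z => F z - G z :=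
  congrArg₂ (· - ·) hg hh

theorem mul (hg : IsGermOf g F) (hh : IsGermOf h G) : IsGermOf (g * h) fun z => F z * G z :=
  congrArg₂ (· * ·) hg hh

theorem pow (hg : IsGermOf g F) (k : ℕ) : IsGermOf (g ^ k) fun z => F z ^ k :=
  congrArg (· ^ k) hg

end IsGermOf

theorem isGermOf_algebraMap (c : ℂ) : IsGermOf (algebraMap ℂ (AnalyticGerm p) c) fun _ => c := rfl

theorem isGermOf_zero : IsGermOf (0 : AnalyticGerm p) fun _ => 0 := rfl

theorem isGermOf_one : IsGermOf (1 : AnalyticGerm p) fun _ => 1 := rfl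

theorem isGermOf_coord (i : Fin n) : IsGermOf (coord p i) fun z => z i := rfl

theorem isGermOf_sum {ι : Type*} (s : Finset ι) {g : ι → AnalyticGerm p}
    {F : ι → (Fin n → ℂ) → ℂ} (h : ∀ i ∈ s, IsGermOf (g i) (F i)) :
    IsGermOf (∑ i ∈ s, g i) fun z => ∑ i ∈ s, F i z := by
  classical
  induction s using Finset.induction_on with
  | empty => simpa using isGermOf_zero
  | insert a s ha ih =>
    simp only [Finset.sum_insert ha]
    exact (h a (Finset.mem_insert_self a s)).add
      (ih fun i hi => h i (Finset.mem_insert_of_mem hi))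

/-- The ring of functions that are holomorphic near `p`. -/
def AnalyticFun (p : Fin n → ℂ) : Subring ((Fin n → ℂ) → ℂ) where
  carrier := {F | AnalyticAt ℂ F p}
  mul_mem' := fun hF hG => AnalyticAt.mul hF hG
  one_mem' := analyticAt_const
  add_mem' := fun hF hG => AnalyticAt.add hF hG
  zero_mem' := analyticAt_const
  neg_mem' := fun hF => AnalyticAt.neg hF

/-- The germ at `p` of a function that is holomorphic near `p`, as a ring homomorphism. -/
def AnalyticFun.germ (p : Fin n → ℂ) : AnalyticFun p →+* AnalyticGerm p where
  toFun F := germOf F.1 F.2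
  map_one' := rfl
  map_mul' _ _ := rfl
  map_zero' := rfl
  map_add' _ _ := rfl

theorem isGermOf_germ (F : AnalyticFun p) : IsGermOf (AnalyticFun.germ p F) F.1 := rfl

/-- The value at `x` of a function that is holomorphic near `p`, as a ring homomorphism. -/
def AnalyticFun.eval (p x : Fin n → ℂ) : AnalyticFun p →+* ℂ :=
  (Pi.evalRingHom (fun _ : Fin n → ℂ => ℂ) x).comp (AnalyticFun p).subtype

theorem AnalyticFun.eval_apply (x : Fin n → ℂ) (F : AnalyticFun p) :
    AnalyticFun.eval p x F = F.1 x := rfl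

/-- The value of a germ at the base point. -/
def evalHom (p : Fin n → ℂ) : AnalyticGerm p →ₐ[ℂ] ℂ where
  __ := (Germ.valueRingHom : Germ (𝓝 p) ℂ →+* ℂ).comp (AnalyticGerm p).subtype
  commutes' _ := rfl

theorem IsGermOf.evalHom_eq {g : AnalyticGerm p} {F : (Fin n → ℂ) → ℂ} (hg : IsGermOf g F) :
    evalHom p g = F p :=
  congrArg Germ.value hg

@[simp] theorem evalHom_coord (i : Fin n) : evalHom p (coord p i) = p i := rfl

theorem mem_vanishingIdeal {g : AnalyticGerm p} : g ∈ vanishingIdeal p ↔ evalHom p g = 0 := Iff.rfl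

theorem isUnit_of_evalHom_ne_zero {g : AnalyticGerm p} (h : evalHom p g ≠ 0) : IsUnit g := by
  obtain ⟨F, hF, hg⟩ := exists_isGermOf g
  rw [hg.evalHom_eq] at h
  refine IsUnit.of_mul_eq_one (germOf _ (hF.inv h)) ?_
  refine ((hg.mul (isGermOf_germOf _)).eq_iff isGermOf_one).2 ?_
  filter_upwards [hF.continuousAt.eventually_ne h] with z hz
  simp [hz]

theorem IsGermOf.pderiv (i : Fin n) {g : AnalyticGerm p} {F : (Fin n → ℂ) → ℂ}
    (hg : IsGermOf g F) : IsGermOf (pderiv i g) (partialDeriv i F) := by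
  obtain ⟨g, hg'⟩ := g
  obtain rfl : g = F := hg
  rfl

theorem pderiv_add (i : Fin n) (g h : AnalyticGerm p) :
    pderiv i (g + h) = pderiv i g + pderiv i h := by
  obtain ⟨F, hF, hg⟩ := exists_isGermOf g
  obtain ⟨G, hG, hh⟩ := exists_isGermOf h
  refine (((hg.add hh).pderiv i).eq_iff ((hg.pderiv i).add (hh.pderiv i))).2 ?_
  filter_upwards [hF.eventually_analyticAt, hG.eventually_analyticAt] with z hz hz'
  simp [partialDeriv, fderiv_fun_add hz.differentiableAt hz'.differentiableAt]

theorem pderiv_mul (i : Fin n) (g h : AnalyticGerm p) :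
    pderiv i (g * h) = g * pderiv i h + h * pderiv i g := by
  obtain ⟨F, hF, hg⟩ := exists_isGermOf g
  obtain ⟨G, hG, hh⟩ := exists_isGermOf h
  refine (((hg.mul hh).pderiv i).eq_iff
    ((hg.mul (hh.pderiv i)).add (hh.mul (hg.pderiv i)))).2 ?_
  filter_upwards [hF.eventually_analyticAt, hG.eventually_analyticAt] with z hz hz'
  simp [partialDeriv, fderiv_fun_mul hz.differentiableAt hz'.differentiableAt]

@[simp] theorem pderiv_algebraMap (i : Fin n) (c : ℂ) :
    pderiv i (algebraMap ℂ (AnalyticGerm p) c) = 0 := by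
  refine (((isGermOf_algebraMap c).pderiv i).eq_iff isGermOf_zero).2
    (Eventually.of_forall fun z => ?_)
  simp [partialDeriv]

/-- The partial derivative `∂/∂zᵢ` as a derivation of the ring of germs. -/
def pderivation (i : Fin n) : Derivation ℂ (AnalyticGerm p) (AnalyticGerm p) where
  toFun := pderiv i
  map_add' := pderiv_add i
  map_smul' c g := by
    rw [Algebra.smul_def, pderiv_mul, pderiv_algebraMap, mul_zero, add_zero, RingHom.id_apply,
      Algebra.smul_def]
  map_one_eq_zero' := by
    have := pderiv_algebraMap (p := p) i 1
    rwa [map_one] at this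
  leibniz' g h := by simp [pderiv_mul]

@[simp] theorem pderivation_apply (i : Fin n) (g : AnalyticGerm p) :
    pderivation i g = pderiv i g := rfl

theorem analyticAt_apply (i : Fin n) : AnalyticAt ℂ (fun z : Fin n → ℂ => z i) p :=
  (ContinuousLinearMap.proj (R := ℂ) (φ := fun _ : Fin n => ℂ) i).analyticAt p

theorem pderiv_coord (i j : Fin n) :
    pderiv i (coord p j) = if j = i then 1 else 0 := by
  have h' : (if j = i then 1 else 0 : AnalyticGerm p) =
      algebraMap ℂ (AnalyticGerm p) (if j = i then 1 else 0) := by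
    split_ifs <;> simp
  rw [h', ((isGermOf_coord j).pderiv i).eq_iff (isGermOf_algebraMap _)]
  refine Eventually.of_forall fun z => ?_
  have : fderiv ℂ (fun z : Fin n → ℂ => z j) z = ContinuousLinearMap.proj j :=
    (ContinuousLinearMap.proj (R := ℂ) (φ := fun _ : Fin n => ℂ) j).fderiv
  simp [partialDeriv, this, Pi.single_apply]

theorem pderiv_comm (i j : Fin n) (g : AnalyticGerm p) :
    pderiv i (pderiv j g) = pderiv j (pderiv i g) := by
  obtain ⟨F, hF, hg⟩ := exists_isGermOf g
  refine (((hg.pderiv j).pderiv i).eq_iff ((hg.pderiv i).pderiv j)).2 ?_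
  filter_upwards [hF.eventually_analyticAt] with z hz
  have hd : DifferentiableAt ℂ (fderiv ℂ F) z := hz.fderiv.differentiableAt
  have key : ∀ a b : Fin n, partialDeriv a (partialDeriv b F) z =
      fderiv ℂ (fderiv ℂ F) z (Pi.single a 1) (Pi.single b 1) := by
    intro a b
    unfold partialDeriv
    rw [fderiv_clm_apply hd (differentiableAt_const _)]
    simp
  rw [key, key]
  exact (hz.contDiffAt (n := ⊤)).isSymmSndFDerivAt_of_omega _ _

/-- The pullback of germs along a holomorphic map `h` with `h q = p`. -/
def pullback {k : ℕ} {q : Fin k → ℂ} (h : (Fin k → ℂ) → (Fin n → ℂ)) (hh : AnalyticAt ℂ h q)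
    (hq : h q = p) : AnalyticGerm p →ₐ[ℂ] AnalyticGerm q where
  toFun g := ⟨g.1.compTendsto h (by simpa [hq] using hh.continuousAt.tendsto), by
    obtain ⟨_, F, hF, rfl⟩ := g
    exact ⟨F ∘ h, AnalyticAt.comp (by rwa [hq]) hh, rfl⟩⟩
  map_one' := rfl
  map_mul' := by
    rintro ⟨_, F, hF, rfl⟩ ⟨_, G, hG, rfl⟩
    rfl
  map_zero' := rfl
  map_add' := by
    rintro ⟨_, F, hF, rfl⟩ ⟨_, G, hG, rfl⟩
    rfl
  commutes' _ := rfl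

theorem IsGermOf.pullback {k : ℕ} {q : Fin k → ℂ} {h : (Fin k → ℂ) → (Fin n → ℂ)}
    (hh : AnalyticAt ℂ h q) (hq : h q = p) {g : AnalyticGerm p} {F : (Fin n → ℂ) → ℂ}
    (hg : IsGermOf g F) : IsGermOf (pullback h hh hq g) fun x => F (h x) := by
  obtain ⟨g, hg'⟩ := g
  obtain rfl : g = F := hg
  rfl

theorem evalHom_pullback {k : ℕ} {q : Fin k → ℂ} {h : (Fin k → ℂ) → (Fin n → ℂ)}
    (hh : AnalyticAt ℂ h q) (hq : h q = p) (g : AnalyticGerm p) :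
    evalHom q (pullback h hh hq g) = evalHom p g := by
  obtain ⟨F, hF, hg⟩ := exists_isGermOf g
  rw [hg.evalHom_eq, (hg.pullback hh hq).evalHom_eq, hq]

theorem pderiv_pullback {k : ℕ} {q : Fin k → ℂ} {h : (Fin k → ℂ) → (Fin n → ℂ)}
    (hh : AnalyticAt ℂ h q) (hq : h q = p) (g : AnalyticGerm p) (i : Fin k) :
    pderiv i (pullback h hh hq g) =
      ∑ j, pullback h hh hq (pderiv j g) * pderiv i (pullback h hh hq (coord p j)) := by
  obtain ⟨F, hF, hg⟩ := exists_isGermOf g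
  refine (((hg.pullback hh hq).pderiv i).eq_iff (isGermOf_sum _ fun j _ =>
    ((hg.pderiv j).pullback hh hq).mul (((isGermOf_coord j).pullback hh hq).pderiv i))).2 ?_
  have hF' : ∀ᶠ x in 𝓝 q, AnalyticAt ℂ F (h x) := by
    refine hh.continuousAt.eventually ?_
    rw [hq]
    exact hF.eventually_analyticAt
  filter_upwards [hh.eventually_analyticAt, hF'] with x hx hFx
  have hc : ∀ j, fderiv ℂ (fun x => h x j) x (Pi.single i 1) =
      fderiv ℂ h x (Pi.single i 1) j := by
    intro j
    rw [fderiv_apply hx.differentiableAt]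
    rfl
  simp only [partialDeriv]
  rw [show (fun x => F (h x)) = F ∘ h from rfl, fderiv_comp x hFx.differentiableAt
    hx.differentiableAt, ContinuousLinearMap.comp_apply]
  conv_lhs => rw [pi_eq_sum_univ' (fderiv ℂ h x (Pi.single i 1)), map_sum]
  refine Finset.sum_congr rfl fun j _ => ?_
  rw [map_smul, hc, smul_eq_mul, mul_comm]

end Germs

/-! ### Power series with arguments in a Banach algebra -/

section Calculus

variable {n : ℕ} (A : Type*) [NormedRing A] [NormedAlgebra ℂ A]

/-- The power series `p` with arguments in the algebra `A`, the variables being multiplied in the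
order in which they occur in the multilinear maps. -/
def extendSeries (p : FormalMultilinearSeries ℂ (Fin n → ℂ) ℂ) :
    FormalMultilinearSeries ℂ (Fin n → A) A := fun k =>
  ∑ c : Fin k → Fin n, p k (fun j => Pi.single (c j) 1) •
    (ContinuousMultilinearMap.mkPiAlgebraFin ℂ k A).compContinuousLinearMap
      fun j => ContinuousLinearMap.proj (c j)

/-- There are `n ^ k` words of length `k`, each with a coefficient of norm at most `‖p k‖`. The
factor `max 1 ‖1‖` accounts for the empty word, as `‖1‖ = 1` is not assumed in `A`. -/
theorem norm_extendSeries_le (p : FormalMultilinearSeries ℂ (Fin n → ℂ) ℂ) (k : ℕ) :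
    ‖extendSeries A p k‖ ≤ max 1 ‖(1 : A)‖ * (n ^ k * ‖p k‖) := by
  refine ContinuousMultilinearMap.opNorm_le_bound (by positivity) fun m => ?_
  have h1 : ∀ c : Fin k → Fin n,
      ‖p k (fun j => Pi.single (c j) 1) • (List.ofFn fun j => m j (c j)).prod‖ ≤
        max 1 ‖(1 : A)‖ * ‖p k‖ * ∏ j, ‖m j‖ := by
    intro c
    rw [norm_smul]
    have h2 : ‖p k (fun j => Pi.single (c j) 1)‖ ≤ ‖p k‖ := by
      refine ((p k).le_opNorm _).trans (mul_le_of_le_one_right (norm_nonneg _) ?_)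
      refine Finset.prod_le_one (fun _ _ => norm_nonneg _) fun j _ => ?_
      rw [pi_norm_le_iff_of_nonneg zero_le_one]
      intro i
      by_cases h : i = c j <;> simp [h]
    have h3 : ‖(List.ofFn fun j => m j (c j)).prod‖ ≤ max 1 ‖(1 : A)‖ * ∏ j, ‖m j‖ := by
      refine ((ContinuousMultilinearMap.mkPiAlgebraFin ℂ k A).le_opNorm _).trans ?_
      refine mul_le_mul ContinuousMultilinearMap.norm_mkPiAlgebraFin_le ?_
        (Finset.prod_nonneg fun _ _ => norm_nonneg _) (by positivity)
      exact Finset.prod_le_prod (fun _ _ => norm_nonneg _) fun j _ => norm_le_pi_norm (m j) (c j)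
    calc _ ≤ ‖p k‖ * (max 1 ‖(1 : A)‖ * ∏ j, ‖m j‖) := mul_le_mul h2 h3 (norm_nonneg _)
            (norm_nonneg _)
      _ = _ := by ring
  have h4 : extendSeries A p k m = ∑ c : Fin k → Fin n,
      p k (fun j => Pi.single (c j) 1) • (List.ofFn fun j => m j (c j)).prod := by
    simp [extendSeries, sum_apply, smul_apply]
  rw [h4]
  refine (norm_sum_le_of_le _ fun c _ => h1 c).trans (le_of_eq ?_)
  simp
  ring

theorem radius_extendSeries_pos {p : FormalMultilinearSeries ℂ (Fin n → ℂ) ℂ}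
    (hp : 0 < p.radius) : 0 < (extendSeries A p).radius := by
  obtain ⟨r, hr0, hr⟩ := ENNReal.lt_iff_exists_nnreal_btwn.1 hp
  obtain ⟨C, hC, h⟩ := p.norm_mul_pow_le_of_lt_radius hr
  have hr0 : 0 < r := by exact_mod_cast hr0
  -- Shrinking the radius by `n + 1` absorbs the `n ^ k` words; `n + 1` instead of `n` keeps the
  -- quotient meaningful for `n = 0`.
  refine lt_of_lt_of_le ?_ (FormalMultilinearSeries.le_radius_of_bound
    (r := r / (n + 1)) _ (max 1 ‖(1 : A)‖ * C) fun k => ?_)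
  · exact_mod_cast div_pos hr0 (by positivity)
  · have h2 : ((r / (n + 1) : NNReal) : ℝ) ^ k = (r : ℝ) ^ k / (n + 1) ^ k := by
      push_cast
      rw [div_pow]
    have h3 : (n : ℝ) ^ k / (n + 1) ^ k ≤ 1 :=
      div_le_one_of_le₀ (by gcongr; linarith) (by positivity)
    calc ‖extendSeries A p k‖ * ((r / (n + 1) : NNReal) : ℝ) ^ k
        ≤ max 1 ‖(1 : A)‖ * (n ^ k * ‖p k‖) * ((r : ℝ) ^ k / (n + 1) ^ k) := by
          rw [h2]
          gcongr
          exact norm_extendSeries_le A p k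
      _ = max 1 ‖(1 : A)‖ * ((‖p k‖ * r ^ k) * (n ^ k / (n + 1) ^ k)) := by ring
      _ ≤ max 1 ‖(1 : A)‖ * (C * 1) := by
          gcongr
          exact h k
      _ = _ := by ring

/-- `Λ` is a simultaneous eigenfunctional of the left multiplications by the `V i`: it strips a word
letter by letter from the left and replaces `V i` by the scalar `v i`. No commutativity in `A` is
needed. -/
theorem apply_extendSeries (p : FormalMultilinearSeries ℂ (Fin n → ℂ) ℂ) (k : ℕ)
    {V : Fin n → A} {v : Fin n → ℂ} {Λ : A →L[ℂ] ℂ} (h : ∀ i a, Λ (V i * a) = v i * Λ a) :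
    Λ (extendSeries A p k fun _ => V) = p k (fun _ => v) * Λ 1 := by
  have hlist : ∀ l : List (Fin n), Λ ((l.map V).prod) = (l.map v).prod * Λ 1 := by
    intro l
    induction l with
    | nil => simp
    | cons i l ih => simp [h, ih, mul_assoc]
  have hv : p k (fun _ => v) = ∑ c : Fin k → Fin n,
      (∏ j, v (c j)) * p k (fun j => Pi.single (c j) 1) := by
    have h1 : (fun _ : Fin k => v) = fun _ => ∑ i, v i • (Pi.single i (1 : ℂ) : Fin n → ℂ) := by
      funext _
      ext i
      simp [Finset.sum_apply, Pi.single_apply]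
    rw [h1]
    erw [(p k).map_sum]
    refine Finset.sum_congr rfl fun c _ => ?_
    erw [(p k).map_smul_univ (fun j => v (c j)) (fun j => Pi.single (c j) (1 : ℂ))]
    rfl
  rw [hv, extendSeries, sum_apply, map_sum, Finset.sum_mul]
  refine Finset.sum_congr rfl fun c _ => ?_
  have := hlist (List.ofFn c)
  rw [List.map_ofFn, List.map_ofFn, List.prod_ofFn (f := v ∘ c)] at this
  simp only [smul_apply,
    ContinuousMultilinearMap.compContinuousLinearMap_apply,
    ContinuousMultilinearMap.mkPiAlgebraFin_apply, ContinuousLinearMap.proj_apply, map_smul,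
    smul_eq_mul]
  rw [show (fun j => V (c j)) = V ∘ c from rfl, this]
  simp only [Function.comp]
  ring

theorem mem_eball_of_norm_lt {E : Type*} [NormedAddCommGroup E] {V : E} {R : NNReal}
    {r : ENNReal} (hV : ‖V‖ < R) (hR : (R : ENNReal) < r) : V ∈ Metric.eball (0 : E) r := by
  refine Metric.mem_eball.2 (lt_trans ?_ hR)
  rw [edist_zero_right, enorm_eq_nnnorm]
  exact_mod_cast hV

/-- A function that is holomorphic near `0` can be evaluated at small tuples of elements of a
Banach algebra. -/
theorem exists_banachAlgebra_extension [CompleteSpace A] {f : (Fin n → ℂ) → ℂ}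
    (hf : AnalyticAt ℂ f 0) :
    ∃ R > 0, ∃ fA : (Fin n → A) → A, (∀ V, ‖V‖ < R → AnalyticAt ℂ fA V) ∧
      ∀ V v (Λ : A →L[ℂ] ℂ), ‖V‖ < R → ‖v‖ < R → (∀ i a, Λ (V i * a) = v i * Λ a) →
        Λ (fA V) = f v * Λ 1 := by
  obtain ⟨p, r, hp⟩ := hf
  have hrad := radius_extendSeries_pos A (hp.r_pos.trans_le hp.r_le)
  obtain ⟨R, hR0, hR⟩ := ENNReal.lt_iff_exists_nnreal_btwn.1 (lt_min hp.r_pos hrad)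
  have hball := (extendSeries A p).hasFPowerSeriesOnBall hrad
  refine ⟨R, by exact_mod_cast hR0, (extendSeries A p).sum, fun V hV => ?_,
    fun V v Λ hV hv h => ?_⟩
  · exact hball.analyticAt_of_mem (mem_eball_of_norm_lt hV (hR.trans_le (min_le_right _ _)))
  · have h1 := hball.hasSum (mem_eball_of_norm_lt hV (hR.trans_le (min_le_right _ _)))
    have h2 := (hp.hasSum (mem_eball_of_norm_lt hv (hR.trans_le (min_le_left _ _)))).mul_right (Λ 1)
    have h3 := Λ.hasSum h1
    rw [zero_add] at h2 h3
    refine h3.unique ?_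
    simp only [apply_extendSeries A p _ h]
    exact h2

end Calculus

/-! ### Bounded sequences as coefficients of power series -/

/-- The series `∑ tᵏ c k` converges in the norm of the dual space on the unit disc. Holomorphy of
`ev` in this norm makes `ev t (a x)` jointly holomorphic in `t` and `x` whenever `a` is holomorphic.
-/
theorem exists_analyticAt_hasSum {E : Type*} [NormedAddCommGroup E] [NormedSpace ℂ E]
    (c : ℕ → E →L[ℂ] ℂ) (hc : ∀ k, ‖c k‖ ≤ 1) :
    ∃ ev : ℂ → E →L[ℂ] ℂ, AnalyticAt ℂ ev 0 ∧
      ∀ t, ‖t‖ < 1 → ∀ a, HasSum (fun k => t ^ k * c k a) (ev t a) := by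
  let p : FormalMultilinearSeries ℂ ℂ (E →L[ℂ] ℂ) := fun k =>
    ContinuousMultilinearMap.mkPiRing ℂ (Fin k) (c k)
  have hp : 1 ≤ p.radius := FormalMultilinearSeries.le_radius_of_bound (r := 1) _ 1 fun k => by
    rw [ContinuousMultilinearMap.norm_mkPiRing]
    simpa using hc k
  have hball := p.hasFPowerSeriesOnBall (zero_lt_one.trans_le hp)
  refine ⟨p.sum, hball.analyticAt, fun t ht a => ?_⟩
  have ht' : t ∈ Metric.eball (0 : ℂ) p.radius := by
    refine Metric.mem_eball.2 (lt_of_lt_of_le ?_ hp)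
    rw [edist_zero_right, enorm_eq_nnnorm]
    exact_mod_cast ht
  have h := hball.hasSum ht'
  rw [zero_add] at h
  simpa [p] using (ContinuousLinearMap.apply ℂ ℂ a).hasSum h

section BoundedSequences

open BoundedContinuousFunction

/-- The space of bounded sequences. -/
abbrev BddSeq : Type := ℕ →ᵇ ℂ

namespace BddSeq

/-- The right shift of bounded sequences. -/
def shift : BddSeq →L[ℂ] BddSeq :=
  LinearMap.mkContinuous
    { toFun := fun a => ofNormedAddCommGroupDiscrete (fun k => Nat.casesOn k 0 fun j => a j) ‖a‖
        (fun k => by cases k <;> simp [a.norm_coe_le_norm])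
      map_add' := fun a b => by ext k; cases k <;> simp
      map_smul' := fun c a => by ext k; cases k <;> simp } 1
    fun a => by
      rw [one_mul, BoundedContinuousFunction.norm_le (norm_nonneg a)]
      intro k
      cases k <;> simp [a.norm_coe_le_norm]

@[simp] theorem shift_zero (a : BddSeq) : shift a 0 = 0 := rfl

@[simp] theorem shift_succ (a : BddSeq) (k : ℕ) : shift a (k + 1) = a k := rfl

/-- The left shift of bounded sequences. -/
def tail : BddSeq →L[ℂ] BddSeq :=
  LinearMap.mkContinuous
    { toFun := fun a => ofNormedAddCommGroupDiscrete (fun k => a (k + 1)) ‖a‖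
        (fun k => a.norm_coe_le_norm _)
      map_add' := fun a b => by ext k; simp
      map_smul' := fun c a => by ext k; simp } 1
    fun a => by
      rw [one_mul, BoundedContinuousFunction.norm_le (norm_nonneg a)]
      intro k
      exact a.norm_coe_le_norm _

@[simp] theorem tail_apply (a : BddSeq) (k : ℕ) : tail a k = a (k + 1) := rfl

theorem tail_pow_apply (a : BddSeq) (d k : ℕ) : (tail ^ d) a k = a (k + d) := by
  induction d generalizing k with
  | zero => rfl
  | succ d ih =>
    rw [pow_succ', mul_apply_eq_comp, tail_apply, ih]
    congr 1
    omega

/-- The sequence `1, 0, 0, …`. -/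
def delta : BddSeq :=
  ofNormedAddCommGroupDiscrete (fun k => if k = 0 then 1 else 0) 1
    (fun k => by split_ifs <;> simp)

/-- The sum at `t` of the power series with values in the dual space whose coefficients are the
coordinate functionals. -/
def eval : ℂ → BddSeq →L[ℂ] ℂ :=
  (exists_analyticAt_hasSum (fun k => evalCLM ℂ k) fun k =>
    ContinuousLinearMap.opNorm_le_bound _ zero_le_one fun a => by
      simpa using a.norm_coe_le_norm k).choose

theorem eval_spec : AnalyticAt ℂ eval 0 ∧
    ∀ t, ‖t‖ < 1 → ∀ a : BddSeq, HasSum (fun k => t ^ k * a k) (eval t a) :=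
  (exists_analyticAt_hasSum (fun k => evalCLM ℂ k) fun k =>
    ContinuousLinearMap.opNorm_le_bound _ zero_le_one fun a => by
      simpa using a.norm_coe_le_norm k).choose_spec

theorem hasSum_eval {t : ℂ} (ht : ‖t‖ < 1) (a : BddSeq) :
    HasSum (fun k => t ^ k * a k) (eval t a) :=
  eval_spec.2 t ht a

theorem eval_delta {t : ℂ} (ht : ‖t‖ < 1) : eval t delta = 1 := by
  refine (hasSum_eval ht delta).unique ?_
  convert hasSum_ite_eq 0 (1 : ℂ) using 2 with k
  by_cases hk : k = 0 <;> simp [delta, hk]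

theorem eval_shift {t : ℂ} (ht : ‖t‖ < 1) (a : BddSeq) :
    eval t (shift a) = t * eval t a := by
  refine (hasSum_eval ht _).unique ?_
  rw [hasSum_nat_add_iff' 1 |>.symm]
  simpa [pow_succ, mul_comm, mul_assoc, mul_left_comm] using (hasSum_eval ht a).mul_left t

/-- The case of division by `t ^ d`: the iterated left shift is the quotient and the first `d`
coefficients are the remainder. General Weierstrass division is a perturbation of this. -/
theorem eval_tail {t : ℂ} (ht : ‖t‖ < 1) (a : BddSeq) (d : ℕ) :
    eval t a =
      t ^ d * eval t ((tail ^ d) a) + ∑ j : Fin d, a j * t ^ (j : ℕ) := by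
  refine (hasSum_eval ht a).unique ?_
  rw [hasSum_nat_add_iff' d |>.symm, ← Fin.sum_univ_eq_sum_range (fun k => t ^ k * a k)]
  have h := (hasSum_eval ht ((tail ^ d) a)).mul_left (t ^ d)
  simp only [tail_pow_apply] at h
  have hs : ∑ j : Fin d, a j * t ^ (j : ℕ) = ∑ j : Fin d, t ^ (j : ℕ) * a j :=
    Finset.sum_congr rfl fun j _ => mul_comm _ _
  rw [hs, add_sub_cancel_right]
  simpa only [pow_add, mul_assoc, mul_left_comm] using h

theorem eq_of_eval_eq {a b : BddSeq}
    (h : ∀ᶠ t in 𝓝 (0 : ℂ), eval t a = eval t b) : a = b := by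
  have hp : ∀ c : BddSeq, HasFPowerSeriesAt (fun t => eval t c)
      (FormalMultilinearSeries.ofScalars ℂ c) 0 := by
    intro c
    rw [hasFPowerSeriesAt_iff]
    filter_upwards [Metric.ball_mem_nhds (0 : ℂ) one_pos] with t ht
    have := hasSum_eval (by simpa using ht) c
    simpa using this
  have := HasFPowerSeriesAt.eq_formalMultilinearSeries_of_eventually (hp a) (hp b) h
  ext k
  have h2 := congrArg (fun q : FormalMultilinearSeries ℂ ℂ ℂ => q.coeff k) this
  simpa using h2

end BddSeq

/-- There is a Banach space `E` of power series in one variable that converge near `0`, with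
continuous coefficient functionals `c k`, evaluation functionals `ev t`, multiplication `S` by the
variable, and left shift `B`. -/
theorem exists_powerSeriesSpace : ∃ (E : Type) (_ : NormedAddCommGroup E) (_ : NormedSpace ℂ E)
    (_ : CompleteSpace E) (S B : E →L[ℂ] E) (c : ℕ → E →L[ℂ] ℂ) (δ : E) (ev : ℂ → E →L[ℂ] ℂ),
    AnalyticAt ℂ ev 0 ∧ (∀ t, ‖t‖ < 1 → ev t δ = 1 ∧ (∀ a, ev t (S a) = t * ev t a) ∧
      ∀ a d, ev t a = t ^ d * ev t ((B ^ d) a) + ∑ j : Fin d, c j a * t ^ (j : ℕ)) ∧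
    ∀ a b, (∀ᶠ t in 𝓝 (0 : ℂ), ev t a = ev t b) → a = b :=
  ⟨BddSeq, inferInstance, inferInstance, inferInstance, BddSeq.shift, BddSeq.tail,
    fun k => evalCLM ℂ k, BddSeq.delta, BddSeq.eval,
    BddSeq.eval_spec.1,
    fun _ ht => ⟨BddSeq.eval_delta ht, BddSeq.eval_shift ht,
      fun a d => BddSeq.eval_tail ht a d⟩,
    fun _ _ => BddSeq.eq_of_eval_eq⟩

end BoundedSequences

/-! ### The Weierstrass division theorem -/

theorem analyticAt_clm_apply {E F G : Type*} [NormedAddCommGroup E] [NormedSpace ℂ E]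
    [NormedAddCommGroup F] [NormedSpace ℂ F] [NormedAddCommGroup G] [NormedSpace ℂ G]
    {u : E → F →L[ℂ] G} {v : E → F} {x : E} (hu : AnalyticAt ℂ u x) (hv : AnalyticAt ℂ v x) :
    AnalyticAt ℂ (fun y => u y (v y)) x :=
  ((ContinuousLinearMap.id ℂ (F →L[ℂ] G)).analyticAt_bilinear (u x, v x)).comp₂ hu hv

/-- **Weierstrass division theorem**, for a divisor that is normalized on the first axis. -/
theorem weierstrass_division {n d : ℕ} {f : (Fin (n + 1) → ℂ) → ℂ} (hf : AnalyticAt ℂ f 0)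
    (hfd : ∀ᶠ t in 𝓝 (0 : ℂ), f (Fin.cons t 0) = t ^ d) {g : (Fin (n + 1) → ℂ) → ℂ}
    (hg : AnalyticAt ℂ g 0) :
    ∃ (q : (Fin (n + 1) → ℂ) → ℂ) (r : Fin d → (Fin n → ℂ) → ℂ), AnalyticAt ℂ q 0 ∧
      (∀ j, AnalyticAt ℂ (r j) 0) ∧
      ∀ᶠ z in 𝓝 0, g z = q z * f z + ∑ j, r j (fun i => z i.succ) * z 0 ^ (j : ℕ) := by
  obtain ⟨E, _, _, _, S, B, c, δ, ev, hev, hev1, hinj⟩ := exists_powerSeriesSpace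
  have hpow : ∀ t, ‖t‖ < 1 → ∀ j : ℕ, ev t ((S ^ j) δ) = t ^ j := by
    intro t ht j
    induction j with
    | zero => simpa using (hev1 t ht).1
    | succ j ih => rw [pow_succ', mul_apply_eq_comp, (hev1 t ht).2.1, ih, pow_succ']
  obtain ⟨R₁, hR₁, fA, hfA, hfA'⟩ := exists_banachAlgebra_extension (E →L[ℂ] E) hf
  obtain ⟨R₂, hR₂, gA, hgA, hgA'⟩ := exists_banachAlgebra_extension (E →L[ℂ] E) hg
  obtain ⟨R, hR, hRR₁, hRR₂⟩ : ∃ R > 0, R ≤ R₁ ∧ R ≤ R₂ :=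
    ⟨min R₁ R₂, lt_min hR₁ hR₂, min_le_left _ _, min_le_right _ _⟩
  -- The first variable is rescaled to `ρ t` with `‖t‖ < 1`. The bound `ρ * ‖S‖ < R` brings the
  -- operators `V x` into the domain of `fA` and `gA`, and `ρ < R` does the same for the points `(ρ
  -- t, x)`.
  obtain ⟨ρ, hρ, hρR, hρS⟩ : ∃ ρ : ℝ, 0 < ρ ∧ ρ < R ∧ ρ * ‖S‖ < R := by
    have h : Tendsto (fun ρ : ℝ => ρ * ‖S‖) (𝓝[>] 0) (𝓝 (0 * ‖S‖)) :=
      (tendsto_id.mul_const _).mono_left nhdsWithin_le_nhds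
    rw [zero_mul] at h
    obtain ⟨ρ, h1, h2, h3⟩ := ((h.eventually_lt_const hR).and
      ((Ioo_mem_nhdsGT hR : _ ∈ 𝓝[>] (0 : ℝ)))).exists
    exact ⟨ρ, h2, h3, h1⟩
  have hρ' : (ρ : ℂ) ≠ 0 := by exact_mod_cast hρ.ne'
  -- The first variable acts on `E` as `ρ S`, the others as scalars. Evaluation at `t` is an
  -- eigenfunctional of these operators, so `fA (V x)` is multiplication by `f(ρ t, x)`.
  let V : (Fin n → ℂ) → Fin (n + 1) → (E →L[ℂ] E) := fun x =>
    Fin.cons (α := fun _ => E →L[ℂ] E) ((ρ : ℂ) • S) fun i => x i • 1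
  have hVa : AnalyticAt ℂ V 0 := by
    refine AnalyticAt.pi fun i => ?_
    refine Fin.cases ?_ (fun i => ?_) i
    · exact analyticAt_const
    · exact (analyticAt_apply i).smul analyticAt_const
  have hVnorm : ∀ᶠ x in 𝓝 0, ‖V x‖ < R := by
    have h0 : ‖V 0‖ < R := by
      rw [pi_norm_lt_iff hR]
      refine Fin.cases ?_ fun i => ?_
      · simpa [V, norm_smul, abs_of_pos hρ] using hρS
      · simpa [V] using hR
    exact hVa.continuousAt.norm.eventually_lt_const h0
  have hV0 : ‖V 0‖ < R := hVnorm.self_of_nhds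
  have hΛ : ∀ x t, ‖t‖ < 1 → ∀ a i (C : E →L[ℂ] E),
      ((ev t).comp (ContinuousLinearMap.apply ℂ E a)) (V x i * C) =
        (Fin.cons (ρ * t) x : Fin (n + 1) → ℂ) i *
          ((ev t).comp (ContinuousLinearMap.apply ℂ E a)) C := by
    intro x t ht a i C
    refine Fin.cases ?_ (fun i => ?_) i
    · simp [V, (hev1 t ht).2.1, mul_assoc]
    · simp [V]
  have hcons : ∀ x t, ‖x‖ < R → ‖t‖ < 1 → ‖(Fin.cons (ρ * t) x : Fin (n + 1) → ℂ)‖ < R := by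
    intro x t hx ht
    rw [pi_norm_lt_iff hR]
    refine Fin.cases ?_ fun i => ?_
    · simp only [Fin.cons_zero, norm_mul, Complex.norm_real, Real.norm_eq_abs, abs_of_pos hρ]
      nlinarith [norm_nonneg t]
    · simpa using (norm_le_pi_norm x i).trans_lt hx
  have hfop : ∀ x t, ‖V x‖ < R → ‖x‖ < R → ‖t‖ < 1 → ∀ a,
      ev t (fA (V x) a) = f (Fin.cons (ρ * t) x) * ev t a :=
    fun x t hVx hx ht a => by
      simpa using hfA' (V x) _ _ (hVx.trans_le hRR₁) ((hcons x t hx ht).trans_le hRR₁)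
        (hΛ x t ht a)
  have hgop : ∀ x t, ‖V x‖ < R → ‖x‖ < R → ‖t‖ < 1 → ∀ a,
      ev t (gA (V x) a) = g (Fin.cons (ρ * t) x) * ev t a :=
    fun x t hVx hx ht a => by
      simpa using hgA' (V x) _ _ (hVx.trans_le hRR₂) ((hcons x t hx ht).trans_le hRR₂)
        (hΛ x t ht a)
  let D : E →L[ℂ] E := ((ρ : ℂ) ^ d)⁻¹ • B ^ d
  let K : E →L[ℂ] E := ∑ j : Fin d,
    (c j).smulRight ((S ^ (j : ℕ)) δ)
  -- A solution of `T x a = g(ρ t, x)` contains the whole division: `D a` is the quotient and the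
  -- first `d` coefficients of `a` are the remainder. At `x = 0` the divisor is `(ρ t) ^ d`, so `T 0
  -- = 1` by `eval_tail`, and `T x` stays invertible nearby.
  let T : (Fin n → ℂ) → (E →L[ℂ] E) := fun x => fA (V x) * D + K
  have hTa : AnalyticAt ℂ T 0 :=
    (((hfA _ (hV0.trans_le hRR₁)).comp hVa).mul analyticAt_const).add analyticAt_const
  have hTeval : ∀ x t, ‖V x‖ < R → ‖x‖ < R → ‖t‖ < 1 → ∀ a, ev t (T x a) =
      f (Fin.cons (ρ * t) x) * ((((ρ : ℂ) ^ d)⁻¹) * ev t ((B ^ d) a)) +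
        ∑ j : Fin d, c j a * t ^ (j : ℕ) := by
    intro x t hVx hx ht a
    simp only [T, D, K, add_apply, mul_apply_eq_comp, map_add, hfop x t hVx hx ht,
      smul_apply, map_smul, smul_eq_mul, sum_apply, map_sum, ContinuousLinearMap.smulRight_apply,
      hpow t ht]
    rw [mul_left_comm]
  have hT0 : T 0 = 1 := by
    refine ContinuousLinearMap.ext fun a => hinj _ _ ?_
    have htend : Tendsto (fun t : ℂ => (ρ : ℂ) * t) (𝓝 0) (𝓝 0) := by
      simpa using (tendsto_id (α := ℂ) (x := 𝓝 0)).const_mul (ρ : ℂ)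
    filter_upwards [htend.eventually hfd, Metric.ball_mem_nhds (0 : ℂ) one_pos] with t ht ht1
    have ht1 : ‖t‖ < 1 := by simpa using ht1
    change _ = ev t a
    rw [hTeval 0 t hV0 (by simpa using hR) ht1, ht, (hev1 t ht1).2.2 a d,
      mul_pow]
    field_simp
  let a : (Fin n → ℂ) → E := fun x => Ring.inverse (T x) (gA (V x) δ)
  have hinv : AnalyticAt ℂ (fun x => Ring.inverse (T x)) 0 := by
    refine AnalyticAt.comp (g := Ring.inverse) ?_ hTa
    rw [hT0]
    exact analyticAt_inverse (𝕜 := ℂ) (A := E →L[ℂ] E) 1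
  have haa : AnalyticAt ℂ a 0 :=
    analyticAt_clm_apply hinv
      (analyticAt_clm_apply ((hgA _ (hV0.trans_le hRR₂)).comp hVa) analyticAt_const)
  have hTunit : ∀ᶠ x in 𝓝 0, IsUnit (T x) := by
    have : {u : E →L[ℂ] E | IsUnit u} ∈ 𝓝 (T 0) := by
      rw [hT0]
      exact Units.nhds (1 : (E →L[ℂ] E)ˣ)
    exact hTa.continuousAt.eventually this
  have hTa' : ∀ᶠ x in 𝓝 0, T x (a x) = gA (V x) δ := by
    filter_upwards [hTunit] with x hx
    rw [← mul_apply_eq_comp, Ring.mul_inverse_cancel _ hx,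
      one_apply_eq_self]
  let P : (Fin (n + 1) → ℂ) →L[ℂ] (Fin n → ℂ) :=
    ContinuousLinearMap.pi fun i => ContinuousLinearMap.proj i.succ
  have hP : Tendsto P (𝓝 0) (𝓝 0) := by simpa using P.continuous.tendsto 0
  have haP : AnalyticAt ℂ (fun z => a (P z)) 0 :=
    AnalyticAt.comp (g := a) (by simpa using haa) (P.analyticAt 0)
  -- Returning to `z 0 = ρ t` turns the remainder coefficient of `t ^ j` into that of `z 0 ^ j`,
  -- whence the factors `ρ ^ (-j)`.
  refine ⟨fun z => ev (z 0 / ρ) (D (a (P z))),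
    fun j x => c j (a x) * ((ρ : ℂ) ^ (j : ℕ))⁻¹, ?_, fun j => ?_, ?_⟩
  · refine analyticAt_clm_apply ?_ (analyticAt_clm_apply analyticAt_const haP)
    refine AnalyticAt.comp (g := ev) (f := fun z : Fin (n + 1) → ℂ => z 0 / ρ)
      ?_ ((analyticAt_apply 0).div_const)
    simpa using hev
  · exact (((c j).analyticAt _).comp haa).mul
      analyticAt_const
  · have h0 : ∀ᶠ z : Fin (n + 1) → ℂ in 𝓝 0, ‖z 0 / ρ‖ < 1 := by
      have : ContinuousAt (fun z : Fin (n + 1) → ℂ => ‖z 0 / ρ‖) 0 :=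
        ((continuous_apply 0).div_const _).norm.continuousAt
      exact this.eventually_lt_const (by simp)
    have hn : ∀ᶠ x : Fin n → ℂ in 𝓝 0, ‖x‖ < R :=
      (continuous_norm.tendsto' _ _ norm_zero).eventually_lt_const hR
    filter_upwards [h0, hP.eventually hVnorm, hP.eventually hn, hP.eventually hTa'] with
      z hz hVz hPz hTz
    have h1 := hTeval (P z) _ hVz hPz hz (a (P z))
    rw [hTz, hgop (P z) _ hVz hPz hz, (hev1 _ hz).1, mul_one,
      mul_div_cancel₀ _ hρ'] at h1
    have hz' : (Fin.cons (z 0) (P z) : Fin (n + 1) → ℂ) = z := Fin.cons_self_tail z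
    rw [hz'] at h1
    rw [h1, mul_comm (f z)]
    simp only [D, smul_apply, map_smul, smul_eq_mul]
    congr 1
    refine Finset.sum_congr rfl fun j _ => ?_
    rw [div_pow, div_eq_mul_inv, show (fun i : Fin n => z i.succ) = P z from rfl]
    ring

/-! ### Division of germs -/

section Division

variable {n : ℕ}

/-- Germs in the variables `x₁, …, xₙ` as germs in the variables `x₀, …, xₙ`. -/
def tailPullback (n : ℕ) :
    AnalyticGerm (0 : Fin n → ℂ) →ₐ[ℂ] AnalyticGerm (0 : Fin (n + 1) → ℂ) :=
  pullback (fun z i => z i.succ) (AnalyticAt.pi fun _ => analyticAt_apply _) rfl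

theorem IsGermOf.tailPullback {g : AnalyticGerm (0 : Fin n → ℂ)} {G : (Fin n → ℂ) → ℂ}
    (hg : IsGermOf g G) : IsGermOf (tailPullback n g) fun z => G fun i => z i.succ :=
  hg.pullback _ _

theorem cons_zero_zero : (Fin.cons 0 0 : Fin (n + 1) → ℂ) = 0 := by
  ext i
  refine Fin.cases ?_ (fun i => ?_) i <;> rfl

theorem analyticAt_cons_zero (x : Fin n → ℂ) :
    AnalyticAt ℂ (fun x : Fin n → ℂ => (Fin.cons 0 x : Fin (n + 1) → ℂ)) x := by
  refine AnalyticAt.pi fun i => ?_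
  refine Fin.cases ?_ (fun i => ?_) i
  · exact analyticAt_const
  · exact analyticAt_apply i

theorem analyticAt_cons_axis (t : ℂ) :
    AnalyticAt ℂ (fun t : ℂ => (Fin.cons t 0 : Fin (n + 1) → ℂ)) t := by
  refine AnalyticAt.pi fun i => ?_
  refine Fin.cases ?_ (fun i => ?_) i
  · exact analyticAt_id
  · exact analyticAt_const

theorem tendsto_cons_axis :
    Tendsto (fun t : ℂ => (Fin.cons t 0 : Fin (n + 1) → ℂ)) (𝓝 0) (𝓝 0) := by
  have h := (analyticAt_cons_axis (n := n) 0).continuousAt.tendsto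
  rwa [cons_zero_zero] at h

/-- Restriction of germs in the variables `x₀, …, xₙ` to the hyperplane `x₀ = 0`. -/
def hyperplaneRestrict (n : ℕ) :
    AnalyticGerm (0 : Fin (n + 1) → ℂ) →ₐ[ℂ] AnalyticGerm (0 : Fin n → ℂ) :=
  pullback (fun x => Fin.cons 0 x) (analyticAt_cons_zero 0) cons_zero_zero

theorem hyperplaneRestrict_coord_zero : hyperplaneRestrict n (coord 0 0) = 0 := rfl

theorem hyperplaneRestrict_tailPullback (g : AnalyticGerm (0 : Fin n → ℂ)) :
    hyperplaneRestrict n (tailPullback n g) = g := by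
  obtain ⟨G, -, hg⟩ := exists_isGermOf g
  exact ((hg.tailPullback.pullback _ _).eq_iff hg).2 (Eventually.of_forall fun _ => rfl)

/-- **Weierstrass division theorem** for germs. -/
theorem weierstrass_division_germ {d : ℕ} {f : AnalyticGerm (0 : Fin (n + 1) → ℂ)}
    {F : (Fin (n + 1) → ℂ) → ℂ} (hf : IsGermOf f F)
    (hfd : ∀ᶠ t in 𝓝 (0 : ℂ), F (Fin.cons t 0) = t ^ d) (g : AnalyticGerm (0 : Fin (n + 1) → ℂ)) :
    ∃ (q : AnalyticGerm (0 : Fin (n + 1) → ℂ)) (r : Fin d → AnalyticFun (0 : Fin n → ℂ)),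
      g = q * f + ∑ j, tailPullback n (AnalyticFun.germ 0 (r j)) * coord 0 0 ^ (j : ℕ) := by
  obtain ⟨G, hG, hg⟩ := exists_isGermOf g
  obtain ⟨q, r, hq, hr, h⟩ := weierstrass_division hf.analyticAt hfd hG
  refine ⟨germOf q hq, fun j => ⟨r j, hr j⟩, ?_⟩
  exact (hg.eq_iff (((isGermOf_germOf hq).mul hf).add (isGermOf_sum _ fun j _ =>
    (isGermOf_germ _).tailPullback.mul ((isGermOf_coord 0).pow _)))).2 h

/-- Weierstrass division by `x₀` with `d = 1`: the remainder does not involve `x₀`, so restriction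
to the hyperplane identifies it. -/
theorem exists_eq_mul_coord_zero_add (g : AnalyticGerm (0 : Fin (n + 1) → ℂ)) :
    ∃ q, g = q * coord 0 0 + tailPullback n (hyperplaneRestrict n g) := by
  obtain ⟨q, r, h⟩ := weierstrass_division_germ (d := 1) (isGermOf_coord (p := 0) (0 : Fin (n + 1)))
    (Eventually.of_forall fun t => by simp) g
  refine ⟨q, ?_⟩
  have h' : g = q * coord 0 0 + tailPullback n (AnalyticFun.germ 0 (r 0)) := by simpa using h
  have h2 := congrArg (hyperplaneRestrict n) h'
  rw [map_add, map_mul, hyperplaneRestrict_coord_zero, mul_zero, zero_add,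
    hyperplaneRestrict_tailPullback] at h2
  rw [h2]
  exact h'

/-- Hadamard's lemma: splitting off a multiple of `x₀` leaves a germ in the other variables, to
which induction applies. -/
theorem vanishingIdeal_zero_eq_span (n : ℕ) :
    vanishingIdeal (0 : Fin n → ℂ) = Ideal.span (Set.range (coord 0)) := by
  refine le_antisymm ?_ ?_
  · induction n with
    | zero =>
      intro g hg
      obtain ⟨G, hG, hgG⟩ := exists_isGermOf g
      rw [mem_vanishingIdeal, hgG.evalHom_eq] at hg
      have : g = 0 := (hgG.eq_iff isGermOf_zero).2 (Eventually.of_forall fun x => by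
        rw [Subsingleton.elim x 0, hg])
      rw [this]
      exact zero_mem _
    | succ n ih =>
      intro g hg
      obtain ⟨q, hq⟩ := exists_eq_mul_coord_zero_add g
      have h1 : hyperplaneRestrict n g ∈ Ideal.span (Set.range (coord 0)) := by
        refine ih ?_
        rw [mem_vanishingIdeal, hyperplaneRestrict, evalHom_pullback]
        exact hg
      rw [hq]
      refine add_mem (Ideal.mul_mem_left _ _ (Ideal.subset_span ⟨0, rfl⟩)) ?_
      have h2 := Ideal.mem_map_of_mem (tailPullback n) h1
      rw [Ideal.map_span] at h2
      refine Ideal.span_mono ?_ h2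
      rintro _ ⟨_, ⟨i, rfl⟩, rfl⟩
      exact ⟨i.succ, rfl⟩
  · rw [Ideal.span_le]
    rintro _ ⟨i, rfl⟩
    rfl

end Division

/-! ### The Nullstellensatz for isolated zeros -/

section Nullstellensatz

/-- The constant coefficient is the limit at `0`, hence zero, and cancelling one factor `t` lowers
`d`; because of the cancellation the identity is asked only off `0`. -/
theorem eq_zero_of_sum_eq_pow_mul {d : ℕ} {b : Fin d → ℂ} {h : ℂ → ℂ} (hh : ContinuousAt h 0)
    (H : ∀ᶠ t in 𝓝[≠] (0 : ℂ), ∑ j, b j * t ^ (j : ℕ) = t ^ d * h t) : b = 0 := by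
  induction d with
  | zero => exact Subsingleton.elim _ _
  | succ d ih =>
    have h1 : Tendsto (fun t : ℂ => ∑ j, b j * t ^ (j : ℕ)) (𝓝[≠] 0) (𝓝 (b 0)) := by
      have : Continuous fun t : ℂ => ∑ j, b j * t ^ (j : ℕ) := by fun_prop
      refine (this.tendsto' 0 _ ?_).mono_left nhdsWithin_le_nhds
      simp [Fin.sum_univ_succ]
    have h2 : Tendsto (fun t : ℂ => t ^ (d + 1) * h t) (𝓝[≠] 0) (𝓝 0) := by
      have : ContinuousAt (fun t : ℂ => t ^ (d + 1) * h t) 0 := by fun_prop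
      simpa [ContinuousAt] using this.tendsto.mono_left nhdsWithin_le_nhds
    have h3 : b 0 = 0 := tendsto_nhds_unique (h1.congr' H) h2
    have h4 : (fun j : Fin d => b j.succ) = 0 := by
      refine ih ?_
      filter_upwards [H, self_mem_nhdsWithin] with t ht ht0
      have ht0 : t ≠ 0 := ht0
      rw [Fin.sum_univ_succ, h3, zero_mul, zero_add] at ht
      refine mul_left_cancel₀ ht0 ?_
      rw [← mul_assoc, ← pow_succ', ← ht, Finset.mul_sum]
      refine Finset.sum_congr rfl fun j _ => ?_
      rw [Fin.val_succ]
      ring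
    funext j
    refine Fin.cases h3 (fun j => ?_) j
    exact congrFun h4 j

/-- If sufficiently many of the combinations `∑ₖ sᵏ Gₖ` have a common root with `W`, then all `Gₖ`
have a common root with `W`. -/
theorem exists_common_root {r : ℕ} {W : Polynomial ℂ} (hW : W ≠ 0) (G : Fin r → Polynomial ℂ)
    (h : ∀ s : Fin (W.natDegree * r + 1), ∃ ρ, W.IsRoot ρ ∧
      ∑ k : Fin r, ((s : ℕ) : ℂ) ^ (k : ℕ) * (G k).eval ρ = 0) :
    ∃ ρ, W.IsRoot ρ ∧ ∀ k, (G k).eval ρ = 0 := by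
  classical
  choose ρ hρ hρ' using h
  -- Pigeonhole: `W` has at most `natDegree W` roots, so one root `y` serves more than `r` values of
  -- `s`. The polynomial `∑ G_k(y) sᵏ` in `s` then has more zeros than its degree allows, and all
  -- its coefficients vanish.
  obtain ⟨y, -, hy⟩ := Finset.exists_lt_card_fiber_of_mul_lt_card_of_maps_to
    (s := Finset.univ) (t := W.roots.toFinset) (f := ρ) (n := r) (fun s _ => by
      simpa [hW] using hρ s) (by
      rw [Finset.card_univ, Fintype.card_fin]
      have := (Multiset.toFinset_card_le W.roots).trans (Polynomial.card_roots' W)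
      exact Nat.lt_succ_of_le (Nat.mul_le_mul_right r this))
  set S := Finset.univ.filter fun s => ρ s = y with hS
  let P : Polynomial ℂ := ∑ k : Fin r, Polynomial.monomial (k : ℕ) ((G k).eval y)
  have hP : P = 0 := by
    refine Polynomial.eq_zero_of_natDegree_lt_card_of_eval_eq_zero' P
      (S.image fun s : Fin (W.natDegree * r + 1) => ((s : ℕ) : ℂ)) ?_ ?_
    · intro t ht
      obtain ⟨s, hs, rfl⟩ := Finset.mem_image.1 ht
      have hsy : ρ s = y := (Finset.mem_filter.1 hs).2
      have := hρ' s
      rw [hsy] at this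
      simpa [P, Polynomial.eval_finsetSum, mul_comm] using this
    · rw [Finset.card_image_of_injective _ fun a b hab => Fin.ext (by exact_mod_cast hab)]
      refine lt_of_le_of_lt ?_ hy
      refine Polynomial.natDegree_sum_le_of_forall_le _ _ fun k _ => ?_
      exact (Polynomial.natDegree_monomial_le _).trans k.2.le
  obtain ⟨s, hs⟩ : S.Nonempty := Finset.card_pos.1 (lt_of_le_of_lt (Nat.zero_le _) hy)
  refine ⟨y, (Finset.mem_filter.1 hs).2 ▸ hρ s, fun k => ?_⟩
  have := congrArg (fun p => p.coeff (k : ℕ)) hP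
  simpa [P, Polynomial.finsetSum_coeff, Polynomial.coeff_monomial, Fin.val_inj] using this

theorem degree_sum_C_mul_X_pow_lt {R : Type*} [CommRing R] {d : ℕ} (b : Fin d → R) :
    (∑ j : Fin d, Polynomial.C (b j) * Polynomial.X ^ (j : ℕ)).degree < (d : WithBot ℕ) := by
  refine (Polynomial.degree_sum_le _ _).trans_lt ((Finset.sup_lt_iff (WithBot.bot_lt_coe d)).2
    fun j _ => (Polynomial.degree_C_mul_X_pow_le _ _).trans_lt ?_)
  exact Nat.cast_lt.2 j.2

/-- If `‖ρ‖ ≥ ε`, then `‖ρ‖ ^ j ≤ ε ^ (-(d - j)) * ‖ρ‖ ^ d`, and summation gives `‖ρ‖ ^ d < ‖ρ‖ ^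
d`. This keeps the roots of a Weierstrass polynomial inside a given ball. -/
theorem norm_lt_of_pow_eq_sum {d : ℕ} {c : Fin d → ℂ} {ρ : ℂ} {ε : ℝ} (hε : 0 < ε)
    (hc : ∑ j, ‖c j‖ * (ε ^ (d - (j : ℕ)))⁻¹ < 1) (h : ρ ^ d = ∑ j, c j * ρ ^ (j : ℕ)) :
    ‖ρ‖ < ε := by
  by_contra! hρ
  have hρ0 : 0 < ‖ρ‖ := hε.trans_le hρ
  have h1 : ‖ρ‖ ^ d ≤ ∑ j, ‖c j‖ * (ε ^ (d - (j : ℕ)))⁻¹ * ‖ρ‖ ^ d := by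
    rw [← norm_pow, h]
    refine norm_sum_le_of_le _ fun j _ => ?_
    rw [norm_mul, norm_pow, mul_assoc, ← h, norm_pow]
    gcongr
    rw [← div_eq_inv_mul, le_div_iff₀ (by positivity)]
    calc ‖ρ‖ ^ (j : ℕ) * ε ^ (d - (j : ℕ)) ≤ ‖ρ‖ ^ (j : ℕ) * ‖ρ‖ ^ (d - (j : ℕ)) := by gcongr
      _ = ‖ρ‖ ^ d := by rw [← pow_add, Nat.add_sub_cancel' j.2.le]
  rw [← Finset.sum_mul] at h1
  have h2 : 0 < ‖ρ‖ ^ d := by positivity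
  nlinarith

/-- **Nullstellensatz** for an isolated zero: if `0` is an isolated common zero of the functions
`F k`, then every germ that vanishes at `0` lies in the radical of the ideal of their germs. -/
theorem vanishingIdeal_le_radical_span {n r : ℕ} (F : Fin r → AnalyticFun (0 : Fin n → ℂ))
    (hF : ∀ᶠ x in 𝓝 (0 : Fin n → ℂ), (∀ k, (F k).1 x = 0) → x = 0) :
    vanishingIdeal (0 : Fin n → ℂ) ≤
      (Ideal.span (Set.range fun k => AnalyticFun.germ 0 (F k))).radical := by
  induction n generalizing r with
  | zero =>
    rw [vanishingIdeal_zero_eq_span, Ideal.span_le]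
    rintro _ ⟨i, rfl⟩
    exact i.elim0
  | succ n ih =>
    set I := Ideal.span (Set.range fun k => AnalyticFun.germ 0 (F k)) with hI
    have hFI : ∀ k, AnalyticFun.germ 0 (F k) ∈ I := fun k => Ideal.subset_span ⟨k, rfl⟩
    -- a function that does not vanish identically on the first axis
    obtain ⟨k₀, hk₀⟩ : ∃ k, ¬ ∀ᶠ t in 𝓝 (0 : ℂ), (F k).1 (Fin.cons t 0) = 0 := by
      by_contra! hcon
      have h1 : ∀ᶠ t in 𝓝 (0 : ℂ), t = 0 := by
        filter_upwards [eventually_all.2 hcon, tendsto_cons_axis.eventually hF] with t ht ht'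
        exact congrFun (ht' ht) 0
      have h2 : ∀ᶠ t in 𝓝[≠] (0 : ℂ), False := by
        filter_upwards [h1.filter_mono nhdsWithin_le_nhds, self_mem_nhdsWithin] with t ht ht'
        exact ht' ht
      exact (Filter.eventually_false_iff_eq_bot.1 h2 ▸ NormedField.nhdsNE_neBot (0 : ℂ)).ne rfl
    have hφ : AnalyticAt ℂ (fun t : ℂ => (F k₀).1 (Fin.cons t 0)) 0 :=
      AnalyticAt.comp (g := (F k₀).1) (by rw [cons_zero_zero]; exact (F k₀).2)
        (analyticAt_cons_axis 0)
    obtain ⟨d, u, hu, hu0, hd⟩ := hφ.exists_eventuallyEq_pow_smul_nonzero_iff.2 hk₀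
    -- On the axis `F k₀` is `t ^ d u(t)` with `u 0 ≠ 0`. Multiplying by `u(z 0)⁻¹` makes it exactly
    -- `t ^ d` there, the normal form required for division.
    have hu' : AnalyticAt ℂ (fun z : Fin (n + 1) → ℂ => (u (z 0))⁻¹) 0 :=
      (AnalyticAt.comp (g := u) (f := fun z : Fin (n + 1) → ℂ => z 0) hu
        (analyticAt_apply 0)).inv hu0
    have hreg : ∀ᶠ t in 𝓝 (0 : ℂ),
        (u ((Fin.cons t 0 : Fin (n + 1) → ℂ) 0))⁻¹ * (F k₀).1 (Fin.cons t 0) = t ^ d := by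
      filter_upwards [hd, hu.continuousAt.eventually_ne hu0] with t ht hut
      rw [ht]
      simp only [Fin.cons_zero, sub_zero, smul_eq_mul]
      field_simp
    -- a Weierstrass polynomial in the ideal
    obtain ⟨q, c, hqc⟩ := weierstrass_division_germ
      ((isGermOf_germOf hu').mul (isGermOf_germ (F k₀))) hreg (coord 0 0 ^ d)
    let w : AnalyticGerm (0 : Fin (n + 1) → ℂ) := coord 0 0 ^ d -
      ∑ j, tailPullback n (AnalyticFun.germ 0 (c j)) * coord 0 0 ^ (j : ℕ)
    have hwI : w ∈ I := by
      have : w = q * (germOf _ hu' * AnalyticFun.germ 0 (F k₀)) := by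
        simp only [w]
        rw [sub_eq_iff_eq_add]
        exact hqc
      rw [this]
      exact Ideal.mul_mem_left _ _ (Ideal.mul_mem_left _ _ (hFI k₀))
    have hw : IsGermOf w fun z => z 0 ^ d - ∑ j, (c j).1 (fun i => z i.succ) * z 0 ^ (j : ℕ) :=
      ((isGermOf_coord 0).pow d).sub (isGermOf_sum _ fun j _ =>
        (isGermOf_germ _).tailPullback.mul ((isGermOf_coord 0).pow _))
    -- On the axis the division reads `t ^ d = Q t ^ d + ∑ c_j(0) t ^ j`, so the last sum is
    -- divisible by `t ^ d` although its degree is less than `d`.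
    have hc0 : ∀ j, (c j).1 0 = 0 := by
      obtain ⟨Q, hQ, hqQ⟩ := exists_isGermOf q
      have h1 := (((isGermOf_coord 0).pow d).eq_iff ((hqQ.mul
        ((isGermOf_germOf hu').mul (isGermOf_germ (F k₀)))).add (isGermOf_sum _ fun j _ =>
          (isGermOf_germ _).tailPullback.mul ((isGermOf_coord 0).pow _)))).1 hqc
      have hQc : ContinuousAt (fun t : ℂ => 1 - Q (Fin.cons t 0)) 0 :=
        continuousAt_const.sub (ContinuousAt.comp (g := Q)
          (by rw [cons_zero_zero]; exact hQ.continuousAt) (analyticAt_cons_axis 0).continuousAt)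
      refine congrFun (eq_zero_of_sum_eq_pow_mul (b := fun j => (c j).1 0) hQc ?_)
      refine Eventually.filter_mono nhdsWithin_le_nhds ?_
      filter_upwards [tendsto_cons_axis.eventually h1, hreg] with t ht ht'
      rw [ht'] at ht
      simp only [Fin.cons_zero, Fin.cons_succ] at ht
      have h0 : (fun _ : Fin n => (0 : ℂ)) = 0 := rfl
      simp only [Pi.zero_apply, h0] at ht
      linear_combination -ht
    have hwreg : ∀ᶠ t in 𝓝 (0 : ℂ), (Fin.cons t 0 : Fin (n + 1) → ℂ) 0 ^ d -
        ∑ j, (c j).1 (fun i => (Fin.cons t 0 : Fin (n + 1) → ℂ) i.succ) *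
          (Fin.cons t 0 : Fin (n + 1) → ℂ) 0 ^ (j : ℕ) = t ^ d := by
      refine Eventually.of_forall fun t => ?_
      have hc0' : ∀ j, (c j).1 (fun _ => 0) = 0 := hc0
      simp [hc0']
    -- As `c_j(0) = 0`, the Weierstrass polynomial `w` is itself normalized on the axis, and every
    -- `F k` is congruent modulo `w` to a polynomial in `z 0`.
    choose Q g hg using fun k => weierstrass_division_germ hw hwreg (AnalyticFun.germ 0 (F k))
    -- elimination of the first variable
    let W : Polynomial (AnalyticFun (0 : Fin n → ℂ)) :=
      Polynomial.X ^ d - ∑ j : Fin d, Polynomial.C (c j) * Polynomial.X ^ (j : ℕ)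
    let G : Fin r → Polynomial (AnalyticFun (0 : Fin n → ℂ)) := fun k =>
      ∑ j : Fin d, Polynomial.C (g k j) * Polynomial.X ^ (j : ℕ)
    have hWnat : W.natDegree ≤ d :=
      Polynomial.natDegree_le_of_degree_le ((Polynomial.degree_sub_le _ _).trans
        (max_le (Polynomial.degree_X_pow_le d) (degree_sum_C_mul_X_pow_lt c).le))
    have hGnat : ∀ s : ℕ, (∑ k : Fin r, (s : Polynomial (AnalyticFun (0 : Fin n → ℂ))) ^ (k : ℕ) *
        G k).natDegree ≤ d + 1 := by
      intro s
      refine Polynomial.natDegree_sum_le_of_forall_le _ _ fun k _ => ?_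
      rw [← Nat.cast_pow, ← nsmul_eq_mul]
      refine (Polynomial.natDegree_smul_le _ _).trans ?_
      exact (Polynomial.natDegree_le_of_degree_le (degree_sum_C_mul_X_pow_lt (g k)).le).trans
        (Nat.le_succ d)
    -- One resultant detects a common root with a single polynomial only; the weights `s ^ k` for `d
    -- * r + 1` values of `s` detect a root common to all `G k`, by `exists_common_root`. The formal
    -- degree `d + 1` is nonzero even for `d = 0`, as the resultant identity requires.
    let E : Fin (d * r + 1) → AnalyticFun (0 : Fin n → ℂ) := fun s =>
      W.resultant (∑ k : Fin r, ((s : ℕ) : Polynomial (AnalyticFun (0 : Fin n → ℂ))) ^ (k : ℕ) *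
        G k) d (d + 1)
    let θ : Polynomial (AnalyticFun (0 : Fin n → ℂ)) →+* AnalyticGerm (0 : Fin (n + 1) → ℂ) :=
      Polynomial.eval₂RingHom ((tailPullback n).toRingHom.comp (AnalyticFun.germ 0)) (coord 0 0)
    have hθW : θ W = w := by simp [θ, W, w, Polynomial.eval₂_finsetSum]
    have hθG : ∀ k, θ (G k) ∈ I := by
      intro k
      have : θ (G k) = AnalyticFun.germ 0 (F k) - Q k * w := by
        rw [hg k]
        simp [θ, G]
      rw [this]
      exact sub_mem (hFI k) (Ideal.mul_mem_left _ _ hwI)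
    have hEI : ∀ s, tailPullback n (AnalyticFun.germ 0 (E s)) ∈ I := by
      intro s
      obtain ⟨a, b, -, -, hab⟩ := Polynomial.exists_mul_add_mul_eq_C_resultant W _ hWnat
        (hGnat s) (Or.inr (Nat.succ_ne_zero d))
      have h1 : tailPullback n (AnalyticFun.germ 0 (E s)) = θ (Polynomial.C (E s)) := by
        simp [θ]
      rw [h1, ← hab, map_add, map_mul, map_mul, map_sum, hθW]
      refine add_mem (Ideal.mul_mem_right _ _ hwI) (Ideal.mul_mem_right _ _ (sum_mem fun k _ => ?_))
      rw [map_mul]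
      exact Ideal.mul_mem_left _ _ (hθG k)
    -- If all `E s` vanish at a small `x`, some root `ρ` of `W` at `x` is a root of all `G k`. It is
    -- small, so `(ρ, x)` is a common zero of the `F k` inside the ball of isolation, which forces
    -- `x = 0`.
    have hEiso : ∀ᶠ x in 𝓝 (0 : Fin n → ℂ), (∀ s, (E s).1 x = 0) → x = 0 := by
      have h1 : ∀ᶠ z in 𝓝 (0 : Fin (n + 1) → ℂ), ∀ k, (F k).1 z =
          (fun z => ∑ j, (g k j).1 (fun i => z i.succ) * z 0 ^ (j : ℕ)) z +
          (Classical.choose (exists_isGermOf (Q k))) z *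
            (z 0 ^ d - ∑ j, (c j).1 (fun i => z i.succ) * z 0 ^ (j : ℕ)) := by
        refine eventually_all.2 fun k => ?_
        have := ((isGermOf_germ (F k)).eq_iff
          (((Classical.choose_spec (exists_isGermOf (Q k))).2.mul hw).add (isGermOf_sum _ fun j _ =>
            (isGermOf_germ _).tailPullback.mul ((isGermOf_coord 0).pow _)))).1 (hg k)
        filter_upwards [this] with z hz
        rw [hz, add_comm]
      obtain ⟨ε, hε, hball⟩ := Metric.eventually_nhds_iff.1 (h1.and hF)
      have hcsmall : ∀ᶠ x in 𝓝 (0 : Fin n → ℂ),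
          ∑ j, ‖(c j).1 x‖ * (ε ^ (d - (j : ℕ)))⁻¹ < 1 := by
        have hcont : ContinuousAt (fun x : Fin n → ℂ =>
            ∑ j, ‖(c j).1 x‖ * (ε ^ (d - (j : ℕ)))⁻¹) 0 :=
          tendsto_finsetSum _ fun j _ => ((c j).2.continuousAt.norm.mul continuousAt_const)
        exact hcont.eventually_lt_const (by simp [hc0])
      filter_upwards [hcsmall, Metric.ball_mem_nhds 0 hε] with x hx hxε hEx
      have hWx : W.map (AnalyticFun.eval 0 x) =
          Polynomial.X ^ d - ∑ j : Fin d, Polynomial.C ((c j).1 x) * Polynomial.X ^ (j : ℕ) := by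
        simp [W, Polynomial.map_sum, AnalyticFun.eval_apply]
      have hlt : (∑ j : Fin d, Polynomial.C ((c j).1 x) * Polynomial.X ^ (j : ℕ)).degree <
          (Polynomial.X ^ d : Polynomial ℂ).degree := by
        rw [Polynomial.degree_X_pow]
        exact degree_sum_C_mul_X_pow_lt _
      have hmonic : (W.map (AnalyticFun.eval 0 x)).Monic := by
        rw [hWx]
        exact (Polynomial.monic_X_pow d).sub_of_left hlt
      have hnat : (W.map (AnalyticFun.eval 0 x)).natDegree = d := by
        refine Polynomial.natDegree_eq_of_degree_eq_some ?_
        rw [hWx, Polynomial.degree_sub_eq_left_of_degree_lt hlt, Polynomial.degree_X_pow]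
      obtain ⟨ρ, hρ, hρG⟩ := exists_common_root hmonic.ne_zero
        (fun k => (G k).map (AnalyticFun.eval 0 x)) (by
          rw [hnat]
          intro s
          have h3 : AnalyticFun.eval 0 x (E s) = 0 := hEx s
          simp only [E] at h3
          rw [← Polynomial.resultant_map_map] at h3
          have h4 := Polynomial.resultant_eq_prod_eval (W.map (AnalyticFun.eval 0 x)) _ (d + 1)
            ((Polynomial.natDegree_map_le (f := AnalyticFun.eval 0 x)).trans (hGnat s))
            (IsAlgClosed.splits _)
          rw [hnat, h3, hmonic.leadingCoeff, one_pow, one_mul] at h4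
          obtain ⟨ρ, hρ, hρ'⟩ := Multiset.mem_map.1 (Multiset.prod_eq_zero_iff.1 h4.symm)
          refine ⟨ρ, (Polynomial.mem_roots'.1 hρ).2, ?_⟩
          simpa [Polynomial.map_sum, Polynomial.eval_finsetSum] using hρ')
      have hρ1 : ρ ^ d = ∑ j, (c j).1 x * ρ ^ (j : ℕ) := by
        rw [hWx] at hρ
        simpa [Polynomial.eval_finsetSum, sub_eq_zero] using hρ
      have hρ2 : ∀ k, ∑ j, (g k j).1 x * ρ ^ (j : ℕ) = 0 := by
        intro k
        simpa [G, Polynomial.map_sum, Polynomial.eval_finsetSum, AnalyticFun.eval_apply]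
          using hρG k
      have hρε := norm_lt_of_pow_eq_sum hε hx hρ1
      have hz : dist (Fin.cons ρ x : Fin (n + 1) → ℂ) 0 < ε := by
        rw [dist_zero_right, pi_norm_lt_iff hε]
        refine Fin.cases (by simpa using hρε) fun i => ?_
        simpa using (norm_le_pi_norm x i).trans_lt (by simpa using hxε)
      obtain ⟨h5, h6⟩ := hball hz
      have h7 := h6 fun k => by
        rw [h5 k]
        simp [hρ2 k, ← hρ1]
      funext i
      exact congrFun h7 i.succ
    have htail : ∀ b ∈ vanishingIdeal (0 : Fin n → ℂ), tailPullback n b ∈ I.radical := by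
      intro b hb
      have h1 : Ideal.span (Set.range fun s => AnalyticFun.germ 0 (E s)) ≤
          I.comap (tailPullback n) := by
        rw [Ideal.span_le]
        rintro _ ⟨s, rfl⟩
        exact hEI s
      have h2 := Ideal.radical_mono h1 (ih E hEiso hb)
      rw [← Ideal.comap_radical] at h2
      exact h2
    -- The `c_j` vanish at `0` and lie in the radical by `htail`; since `w ∈ I`, so does `x₀ ^ d`.
    have hcoord : coord 0 0 ∈ I.radical := by
      refine Ideal.radical_isRadical I ⟨d, ?_⟩
      have : (coord 0 0 : AnalyticGerm (0 : Fin (n + 1) → ℂ)) ^ d = w +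
          ∑ j, tailPullback n (AnalyticFun.germ 0 (c j)) * coord 0 0 ^ (j : ℕ) := by simp [w]
      rw [this]
      refine add_mem (Ideal.le_radical hwI) (sum_mem fun j _ => Ideal.mul_mem_right _ _ ?_)
      exact htail _ (hc0 j)
    intro b hb
    obtain ⟨q', hq'⟩ := exists_eq_mul_coord_zero_add b
    rw [hq']
    refine add_mem (Ideal.mul_mem_left _ _ hcoord) (htail _ ?_)
    rw [mem_vanishingIdeal, hyperplaneRestrict, evalHom_pullback]
    exact hb

end Nullstellensatz

/-! ### The socle of a finite-dimensional complete intersection -/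

section Socle

open TensorProduct

variable {k σ : Type*} [Field k]

/-- The difference `P(X) - P(Y)` is a combination of the differences `Xⱼ - Yⱼ`, with coefficients
that restrict to the partial derivatives of `P` on the diagonal. -/
theorem exists_bezoutian_row [Fintype σ] [DecidableEq σ] (P : MvPolynomial σ k) :
    ∃ b : σ → MvPolynomial σ k ⊗[k] MvPolynomial σ k,
      P ⊗ₜ[k] 1 - 1 ⊗ₜ[k] P = ∑ j, b j * (MvPolynomial.X j ⊗ₜ[k] 1 - 1 ⊗ₜ[k] MvPolynomial.X j) ∧
      ∀ j, Algebra.TensorProduct.lmul' k (b j) = MvPolynomial.pderiv j P := by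
  induction P using MvPolynomial.induction_on with
  | C c =>
    refine ⟨0, ?_, fun j => by simp⟩
    have : (MvPolynomial.C c : MvPolynomial σ k) = c • 1 := by
      rw [MvPolynomial.smul_eq_C_mul, mul_one]
    rw [this, TensorProduct.smul_tmul]
    simp
  | add p q hp hq =>
    obtain ⟨b, hb, hb'⟩ := hp
    obtain ⟨c, hc, hc'⟩ := hq
    refine ⟨b + c, ?_, fun j => by simp [hb', hc']⟩
    simp only [Pi.add_apply, add_mul, Finset.sum_add_distrib, ← hb, ← hc, add_tmul, tmul_add]
    abel
  | mul_X p i hp =>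
    obtain ⟨b, hb, hb'⟩ := hp
    refine ⟨fun j => b j * (MvPolynomial.X i ⊗ₜ[k] 1) + if j = i then 1 ⊗ₜ[k] p else 0, ?_,
      fun j => ?_⟩
    · have h1 : ∑ j, (b j * (MvPolynomial.X i ⊗ₜ[k] 1) + if j = i then 1 ⊗ₜ[k] p else 0) *
          (MvPolynomial.X j ⊗ₜ[k] 1 - 1 ⊗ₜ[k] MvPolynomial.X j) =
          (∑ j, b j * (MvPolynomial.X j ⊗ₜ[k] 1 - 1 ⊗ₜ[k] MvPolynomial.X j)) *
            (MvPolynomial.X i ⊗ₜ[k] 1) +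
          1 ⊗ₜ[k] p * (MvPolynomial.X i ⊗ₜ[k] 1 - 1 ⊗ₜ[k] MvPolynomial.X i) := by
        simp only [add_mul, Finset.sum_add_distrib, ite_mul, zero_mul, Finset.sum_ite_eq',
          Finset.mem_univ, if_true, Finset.sum_mul]
        congr 1
        exact Finset.sum_congr rfl fun j _ => by ring
      rw [h1, ← hb, sub_mul, mul_sub]
      simp only [Algebra.TensorProduct.tmul_mul_tmul, one_mul, mul_one]
      abel
    · rw [map_add, map_mul, hb', MvPolynomial.pderiv_mul, MvPolynomial.pderiv_X]
      by_cases h : j = i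
      · subst h
        simp
      · simp [h, Ne.symm h]

/-- The contraction of the first tensor factor with a linear form. -/
def contractFst {Q : Type*} [CommRing Q] [Algebra k Q] (l : Module.Dual k Q) : Q ⊗[k] Q →ₗ[k] Q :=
  (TensorProduct.lid k Q).toLinearMap ∘ₗ LinearMap.rTensor Q l

@[simp] theorem contractFst_tmul {Q : Type*} [CommRing Q] [Algebra k Q] (l : Module.Dual k Q)
    (a b : Q) : contractFst l (a ⊗ₜ b) = l a • b := by
  simp [contractFst]

theorem contractFst_one_tmul_mul {Q : Type*} [CommRing Q] [Algebra k Q] (l : Module.Dual k Q)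
    (q : Q) (z : Q ⊗[k] Q) : contractFst l ((1 ⊗ₜ q) * z) = q * contractFst l z := by
  induction z with
  | zero => simp
  | tmul a b => simp
  | add a b ha hb => rw [mul_add, map_add, map_add, ha, hb, mul_add]

theorem contractFst_tmul_one_mul {Q : Type*} [CommRing Q] [Algebra k Q] (l : Module.Dual k Q)
    (q : Q) (z : Q ⊗[k] Q) :
    contractFst l ((q ⊗ₜ 1) * z) = contractFst (l ∘ₗ LinearMap.mulLeft k q) z := by
  induction z with
  | zero => simp
  | tmul a b => simp
  | add a b ha hb => rw [mul_add, map_add, map_add, ha, hb]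

/-- Let `Q` be a finite-dimensional local algebra with residue field `k` of characteristic zero,
generated by elements `π Xⱼ` of its maximal ideal that satisfy polynomial equations `Pᵢ`, equal in
number to the generators. If `π (det T) ≠ 0` whenever `P = T X`, then the socle of `Q` is
generated by the Jacobian determinant of `P`. -/
theorem socle_eq_span_jacobian [CharZero k] [Fintype σ] [DecidableEq σ] {Q : Type*} [CommRing Q]
    [Algebra k Q] [FiniteDimensional k Q] (π : MvPolynomial σ k →ₐ[k] Q)
    (hπ : Function.Surjective π) (ε : Q →ₐ[k] k) (hε : ∀ j, ε (π (MvPolynomial.X j)) = 0)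
    (hnil : ∀ a, ε a = 0 → IsNilpotent a) (P : σ → MvPolynomial σ k) (hP : ∀ i, π (P i) = 0)
    (hT : ∀ T : Matrix σ σ (MvPolynomial σ k), (∀ i, P i = ∑ j, T i j * MvPolynomial.X j) →
      π T.det ≠ 0) (s : Q) :
    (∀ a, ε a = 0 → s * a = 0) ↔
      ∃ c, s = c * π (Matrix.of fun i j => MvPolynomial.pderiv j (P i)).det := by
  set J := π (Matrix.of fun i j => MvPolynomial.pderiv j (P i)).det with hJ
  choose b hb hb' using fun i => exists_bezoutian_row (P i)
  let B : Matrix σ σ (MvPolynomial σ k ⊗[k] MvPolynomial σ k) := Matrix.of b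
  let Θ : MvPolynomial σ k ⊗[k] MvPolynomial σ k →ₐ[k] Q ⊗[k] Q := Algebra.TensorProduct.map π π
  let Δ : Q ⊗[k] Q := Θ B.det
  have hdiff : ∀ p, Θ (p ⊗ₜ 1 - 1 ⊗ₜ p) = π p ⊗ₜ 1 - 1 ⊗ₜ π p := fun p => by simp [Θ]
  -- The `P i` die in `Q`, so the Bezoutian matrix kills the vector of the `Xⱼ ⊗ 1 - 1 ⊗ Xⱼ`; by
  -- Cramer's rule its determinant does too.
  have hΔX : ∀ j, Δ * (π (MvPolynomial.X j) ⊗ₜ 1 - 1 ⊗ₜ π (MvPolynomial.X j)) = 0 := by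
    let v : σ → Q ⊗[k] Q := fun j => π (MvPolynomial.X j) ⊗ₜ 1 - 1 ⊗ₜ π (MvPolynomial.X j)
    have hBv : (B.map Θ).mulVec v = 0 := by
      funext i
      have := congrArg Θ (hb i)
      rw [hdiff, hP, map_sum] at this
      simp only [map_mul, hdiff, zero_tmul, tmul_zero, sub_zero] at this
      exact this.symm
    have h1 : (B.map Θ).det • v = 0 := by
      have h2 := congrArg (fun M => Matrix.mulVec M v) (Matrix.adjugate_mul (B.map Θ))
      simp only [← Matrix.mulVec_mulVec, hBv, Matrix.mulVec_zero, Matrix.smul_mulVec,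
        Matrix.one_mulVec] at h2
      exact h2.symm
    intro j
    have hdet : Δ = (B.map Θ).det := AlgHom.map_det Θ B
    rw [hdet]
    exact congrFun h1 j
  have hΔ : ∀ q : Q, (q ⊗ₜ 1) * Δ = (1 ⊗ₜ q) * Δ := by
    intro q
    obtain ⟨p, rfl⟩ := hπ q
    induction p using MvPolynomial.induction_on with
    | C c =>
      have : π (MvPolynomial.C c) = c • 1 := by
        rw [← mul_one (MvPolynomial.C c), ← MvPolynomial.smul_eq_C_mul, map_smul, map_one]
      rw [this, TensorProduct.smul_tmul]
    | add p q hp hq => rw [map_add, add_tmul, tmul_add, add_mul, add_mul, hp, hq]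
    | mul_X p i hp =>
      have h1 : (π (MvPolynomial.X i) ⊗ₜ[k] (1 : Q)) * Δ = (1 ⊗ₜ π (MvPolynomial.X i)) * Δ := by
        have := hΔX i
        rw [mul_sub, sub_eq_zero] at this
        rw [mul_comm, this, mul_comm]
      have h2 : ∀ a c : Q, (a * c) ⊗ₜ[k] (1 : Q) = (a ⊗ₜ 1) * (c ⊗ₜ 1) := by simp
      have h3 : ∀ a c : Q, (1 : Q) ⊗ₜ[k] (a * c) = (1 ⊗ₜ a) * (1 ⊗ₜ c) := by simp
      rw [map_mul, h2, h3, mul_assoc, h1, mul_left_comm, hp]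
      ring
  have hlmul : Algebra.TensorProduct.lmul' k Δ = J := by
    have h1 : (Algebra.TensorProduct.lmul' k).comp Θ = π.comp (Algebra.TensorProduct.lmul' k) := by
      ext <;> simp [Θ]
    have h2 := DFunLike.congr_fun h1 B.det
    simp only [AlgHom.comp_apply] at h2
    rw [h2, hJ, AlgHom.map_det]
    congr 2
    ext i j
    exact congrArg _ (hb' i j)
  -- the restriction of the Bezoutian to `Y = 0`
  let e : MvPolynomial σ k →ₐ[k] k := ε.comp π
  let R : MvPolynomial σ k ⊗[k] MvPolynomial σ k →ₐ[k] MvPolynomial σ k :=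
    Algebra.TensorProduct.lift (AlgHom.id k _) ((Algebra.ofId k _).comp e) fun _ _ => Commute.all _ _
  let T : Matrix σ σ (MvPolynomial σ k) := B.map R
  have hTP : ∀ i, P i = ∑ j, T i j * MvPolynomial.X j := by
    intro i
    have := congrArg R (hb i)
    simpa [R, hP, e, hε, T, B] using this
  have hTdet : T.det = R B.det := (AlgHom.map_det R B).symm
  have hεcontract : ∀ (l : Module.Dual k Q) z, ε (contractFst l (Θ z)) = l (π (R z)) := by
    intro l z
    induction z with
    | zero => simp
    | tmul a c =>
      have : π (R (a ⊗ₜ c)) = e c • π a := by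
        simp [R, Algebra.ofId_apply, Algebra.smul_def, mul_comm]
      rw [this]
      simp [Θ, e, mul_comm]
    | add a c ha hc => simp only [map_add, ha, hc]
  obtain ⟨l, hl⟩ : ∃ l : Module.Dual k Q, l (π T.det) ≠ 0 := by
    by_contra! h
    exact hT T hTP ((Module.forall_dual_apply_eq_zero_iff k _).1 h)
  -- Applying `ε` to the second tensor factor turns `Δ` into the class of `det T`, so the
  -- contraction has nonzero residue `l (π T.det)`, and the rest of it is nilpotent.
  have hu : IsUnit (contractFst l Δ) := by
    have h1 : ε (contractFst l Δ) ≠ 0 := by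
      rw [hεcontract, ← hTdet]
      exact hl
    have h2 : IsNilpotent (contractFst l Δ - algebraMap k Q (ε (contractFst l Δ))) :=
      hnil _ (by simp)
    have h3 := h2.isUnit_add_left_of_commute ((IsUnit.mk0 _ h1).map (algebraMap k Q))
      (Commute.all _ _)
    simpa using h3
  obtain ⟨u, hu⟩ := hu
  -- Rescaling by `u⁻¹` makes the contraction equal to `1`. By `hΔ`, contraction with `η(h ·)` then
  -- returns `h`: the form `η(ab)` is nondegenerate and `Δ` is its inverse tensor.
  let η : Module.Dual k Q := l ∘ₗ LinearMap.mulLeft k (↑u⁻¹ : Q)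
  have hη : contractFst η Δ = 1 := by
    rw [← contractFst_tmul_one_mul, hΔ, contractFst_one_tmul_mul, ← hu, Units.inv_mul]
  have hηh : ∀ h : Q, contractFst (η ∘ₗ LinearMap.mulLeft k h) Δ = h := by
    intro h
    rw [← contractFst_tmul_one_mul, hΔ, contractFst_one_tmul_mul, hη, mul_one]
  have hfaith : ∀ a : Q, (∀ h, η (a * h) = 0) → a = 0 := by
    intro a ha
    have h1 : η ∘ₗ LinearMap.mulLeft k a = 0 := LinearMap.ext ha
    rw [← hηh a, h1]
    simp [contractFst]
  obtain ⟨S, hS⟩ := TensorProduct.exists_finset Δ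
  -- With `Δ = ∑ a_i ⊗ b_i`, every `q` is `∑ η(q a_i) b_i`. Multiplication by `h` is thus a sum of
  -- rank-one maps of total trace `η(h ∑ a_i b_i)`, and `∑ a_i b_i = J`.
  have htrace : ∀ h : Q, LinearMap.trace k Q (LinearMap.mulLeft k h) = η (h * J) := by
    intro h
    have h1 : LinearMap.mulLeft k h =
        ∑ i ∈ S, (η ∘ₗ LinearMap.mulRight k i.1).smulRight (h * i.2) := by
      ext q
      have h2 := hηh q
      rw [hS, map_sum] at h2
      simp only [contractFst_tmul, LinearMap.comp_apply, LinearMap.mulLeft_apply] at h2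
      simp only [LinearMap.mulLeft_apply, LinearMap.sum_apply, LinearMap.smulRight_apply,
        LinearMap.comp_apply, LinearMap.mulRight_apply]
      conv_lhs => rw [← h2, Finset.mul_sum]
      exact Finset.sum_congr rfl fun i _ => by rw [mul_smul_comm]
    rw [h1, map_sum, ← hlmul, hS, map_sum, Finset.mul_sum, map_sum]
    refine Finset.sum_congr rfl fun i _ => ?_
    rw [LinearMap.trace_smulRight]
    simp only [LinearMap.comp_apply, LinearMap.mulRight_apply, Algebra.TensorProduct.lmul'_apply_tmul]
    congr 1
    ring
  have htrace0 : ∀ h : Q, ε h = 0 → η (h * J) = 0 := by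
    intro h hh
    obtain ⟨N, hN⟩ := hnil h hh
    rw [← htrace]
    refine (LinearMap.isNilpotent_trace_of_isNilpotent ⟨N, ?_⟩).eq_zero
    rw [LinearMap.pow_mulLeft, hN, LinearMap.mulLeft_zero_eq_zero]
  constructor
  · intro hs
    have hdim : (Module.finrank k Q : k) ≠ 0 := by
      have : Nontrivial Q := ε.toRingHom.domain_nontrivial
      exact_mod_cast (Module.finrank_pos (R := k) (M := Q)).ne'
    -- Both `s` and `J` pair to zero with the maximal ideal, so each is determined by its value
    -- under `η`. As `η J = dim Q`, nonzero in characteristic zero, the factor is forced.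
    refine ⟨algebraMap k Q (η s / Module.finrank k Q), ?_⟩
    rw [← sub_eq_zero]
    refine hfaith _ fun h => ?_
    have h1 : h = algebraMap k Q (ε h) + (h - algebraMap k Q (ε h)) := by ring
    have h2 : s * (h - algebraMap k Q (ε h)) = 0 := hs _ (by simp)
    have h3 : η ((h - algebraMap k Q (ε h)) * J) = 0 := htrace0 _ (by simp)
    have h4 : η J = Module.finrank k Q := by
      have := htrace 1
      rw [one_mul, LinearMap.mulLeft_one, LinearMap.trace_id] at this
      exact this.symm
    have h5 : (s - algebraMap k Q (η s / Module.finrank k Q) * J) * h =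
        ε h • s + s * (h - algebraMap k Q (ε h)) - (η s / Module.finrank k Q) • (ε h • J) -
          (η s / Module.finrank k Q) • ((h - algebraMap k Q (ε h)) * J) := by
      simp only [Algebra.smul_def]
      ring
    rw [h5, h2]
    simp only [map_sub, map_add, map_smul, smul_eq_mul, map_zero, h3, h4]
    field_simp
    ring
  · rintro ⟨c, rfl⟩ a ha
    refine hfaith _ fun h => ?_
    rw [show c * J * a * h = (c * a * h) * J by ring]
    exact htrace0 _ (by simp [ha])

end Socle

/-! ### Taylor coefficients of germs -/

section Taylor

variable {n : ℕ}

/-- Iterated partial derivatives of a germ. -/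
def iterPderiv (l : List (Fin n)) (g : AnalyticGerm (0 : Fin n → ℂ)) :
    AnalyticGerm (0 : Fin n → ℂ) :=
  l.foldr pderiv g

theorem iterPderiv_add (l : List (Fin n)) (g h : AnalyticGerm (0 : Fin n → ℂ)) :
    iterPderiv l (g + h) = iterPderiv l g + iterPderiv l h := by
  induction l with
  | nil => rfl
  | cons i l ih => exact (congrArg (pderiv i) ih).trans (pderiv_add i _ _)

theorem pderiv_iterPderiv_erase {i : Fin n} {l : List (Fin n)} (hi : i ∈ l)
    (g : AnalyticGerm (0 : Fin n → ℂ)) :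
    pderiv i (iterPderiv (l.erase i) g) = iterPderiv l g := by
  induction l with
  | nil => simp at hi
  | cons j l ih =>
    by_cases h : j = i
    · subst h
      rw [List.erase_cons_head]
      rfl
    · have hi' : i ∈ l := (List.mem_cons.1 hi).resolve_left (Ne.symm h)
      rw [List.erase_cons_tail (by simpa using h)]
      exact (pderiv_comm i j _).trans (congrArg (pderiv j) (ih hi'))

/-- Leibniz' rule: only one derivative can fall on `xᵢ`, and the `count` occurrences of `i` in the
word give equal terms because partial derivatives commute. -/
theorem iterPderiv_coord_mul (i : Fin n) (l : List (Fin n)) (g : AnalyticGerm (0 : Fin n → ℂ)) :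
    iterPderiv l (coord 0 i * g) =
      coord 0 i * iterPderiv l g + (l.count i : AnalyticGerm (0 : Fin n → ℂ)) *
        iterPderiv (l.erase i) g := by
  induction l with
  | nil => simp [iterPderiv]
  | cons j l ih =>
    have h0 : ∀ h, iterPderiv (j :: l) h = pderiv j (iterPderiv l h) := fun _ => rfl
    have hc : pderiv j (l.count i : AnalyticGerm (0 : Fin n → ℂ)) = 0 :=
      (pderivation j).map_natCast _
    rw [h0, ih, pderiv_add, pderiv_mul, pderiv_mul, pderiv_coord, hc, h0]
    by_cases h : i = j
    · subst h
      rw [List.count_cons_self, List.erase_cons_head]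
      by_cases hi : i ∈ l
      · rw [pderiv_iterPderiv_erase hi]
        push_cast
        simp
        ring
      · rw [List.count_eq_zero_of_not_mem hi]
        simp
    · rw [List.count_cons_of_ne (Ne.symm h), List.erase_cons_tail (by simpa using Ne.symm h)]
      simp [h, iterPderiv]

/-- The Taylor coefficient of a germ at `0`, up to a factor, for the monomial given by a list of
variables. -/
def taylorCoeff (l : List (Fin n)) : AnalyticGerm (0 : Fin n → ℂ) →+ ℂ where
  toFun g := evalHom 0 (iterPderiv l g)
  map_zero' := by
    have := iterPderiv_add l 0 0
    rw [add_zero, left_eq_add] at this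
    rw [this, map_zero]
  map_add' g h := by rw [iterPderiv_add, map_add]

theorem taylorCoeff_coord_mul (i : Fin n) (l : List (Fin n)) (g : AnalyticGerm (0 : Fin n → ℂ)) :
    taylorCoeff l (coord 0 i * g) = l.count i * taylorCoeff (l.erase i) g := by
  change evalHom 0 (iterPderiv l _) = _ * evalHom 0 (iterPderiv _ g)
  rw [iterPderiv_coord_mul]
  simp

theorem taylorCoeff_coord_pow_mul {i : Fin n} {N : ℕ} {l : List (Fin n)} (h : l.count i < N)
    (g : AnalyticGerm (0 : Fin n → ℂ)) : taylorCoeff l (coord 0 i ^ N * g) = 0 := by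
  induction N generalizing l with
  | zero => exact absurd h (Nat.not_lt_zero _)
  | succ N ih =>
    rw [pow_succ', mul_assoc, taylorCoeff_coord_mul]
    by_cases h0 : l.count i = 0
    · simp [h0]
    · rw [ih, mul_zero]
      rw [List.count_erase_self]
      omega

theorem taylorCoeff_eq_zero_of_mem_span {N : ℕ} {l : List (Fin n)} (h : ∀ i, l.count i < N)
    {g : AnalyticGerm (0 : Fin n → ℂ)}
    (hg : g ∈ Ideal.span (Set.range fun i => (coord 0 i : AnalyticGerm (0 : Fin n → ℂ)) ^ N)) :
    taylorCoeff l g = 0 := by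
  obtain ⟨a, rfl⟩ := Ideal.mem_span_range_iff_exists_fun.1 hg
  rw [map_sum]
  exact Finset.sum_eq_zero fun i _ => by rw [mul_comm, taylorCoeff_coord_pow_mul (h i)]

theorem taylorCoeff_prod_ne_zero (l l' : List (Fin n)) (h : l.Perm l') :
    taylorCoeff l (l'.map (coord 0)).prod ≠ 0 := by
  induction l' generalizing l with
  | nil =>
    rw [h.eq_nil]
    simp [taylorCoeff, iterPderiv]
  | cons i l' ih =>
    have h1 := h.erase i
    rw [List.erase_cons_head] at h1
    rw [List.map_cons, List.prod_cons, taylorCoeff_coord_mul]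
    refine mul_ne_zero ?_ (ih _ h1)
    have : i ∈ l := h.mem_iff.2 List.mem_cons_self
    exact_mod_cast (List.count_pos_iff.2 this).ne'

/-- If `U x = (x₁ᴺ, …, xₙᴺ)`, then `det U` is not in the ideal `(x₁ᴺ, …, xₙᴺ)`. -/
theorem det_notMem_span_coord_pow {N : ℕ} (hN : N ≠ 0)
    (U : Matrix (Fin n) (Fin n) (AnalyticGerm (0 : Fin n → ℂ)))
    (hU : U.mulVec (coord 0) = fun i => coord 0 i ^ N) :
    U.det ∉ Ideal.span (Set.range fun i => (coord 0 i : AnalyticGerm (0 : Fin n → ℂ)) ^ N) := by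
  -- The word `L` stands for `(x₁ ⋯ xₙ) ^ (N - 1)`, whose coefficient vanishes on the ideal `(xᵢᴺ)`.
  -- In `det U` this coefficient is the same for all admissible `U`, so it can be read off from the
  -- diagonal matrix with entries `xᵢ ^ (N - 1)`.
  let M : Multiset (Fin n) := (N - 1) • Finset.univ.val
  let L := M.toList
  have hL : ∀ i, L.count i = N - 1 := by
    intro i
    rw [← Multiset.coe_count, Multiset.coe_toList, Multiset.count_nsmul,
      Multiset.count_eq_one_of_mem Finset.univ.nodup (Finset.mem_univ i), mul_one]
  have hlt : ∀ i, L.count i < N := fun i => by rw [hL]; omega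
  -- changing one row does not change the coefficient
  have hrow : ∀ (V : Matrix (Fin n) (Fin n) (AnalyticGerm (0 : Fin n → ℂ))) (i : Fin n)
      (v : Fin n → AnalyticGerm (0 : Fin n → ℂ)), V.mulVec (coord 0) = (fun i => coord 0 i ^ N) →
      v ⬝ᵥ coord 0 = coord 0 i ^ N → taylorCoeff L (V.updateRow i v).det = taylorCoeff L V.det := by
    intro V i v hV hv
    have h1 : (V.updateRow i v).det = V.det + (V.updateRow i (v - V i)).det := by
      have := Matrix.det_updateRow_add V i (V i) (v - V i)
      rwa [add_sub_cancel, Matrix.updateRow_eq_self] at this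
    rw [h1, map_add, add_eq_left]
    set W := V.updateRow i (v - V i) with hW
    have h2 : ∀ k, W.mulVec (coord 0) k = if k = i then 0 else coord 0 k ^ N := by
      intro k
      split_ifs with hk
      · subst hk
        rw [Matrix.mulVec, hW, Matrix.updateRow_self, sub_dotProduct, hv]
        have := congrFun hV k
        rw [Matrix.mulVec] at this
        rw [this, sub_self]
      · rw [Matrix.mulVec, hW, Matrix.updateRow_ne hk]
        exact congrFun hV k
    -- Row `i` of `W` kills `x`, so by Cramer's rule `xᵢ det W` lies in the ideal of the `x_kᴺ` with
    -- `k ≠ i`. The coefficient of `xᵢ (x₁ ⋯ xₙ) ^ (N - 1)` vanishes there, hence so does that of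
    -- `L` in `det W`.
    have h3 : coord 0 i * W.det = ∑ k, W.adjugate i k * if k = i then 0 else coord 0 k ^ N := by
      have h4 := congrFun (congrArg (fun M => Matrix.mulVec M (coord 0))
        (Matrix.adjugate_mul W)) i
      simp only [← Matrix.mulVec_mulVec, Matrix.smul_mulVec, Matrix.one_mulVec, Pi.smul_apply,
        smul_eq_mul] at h4
      rw [mul_comm, ← h4, Matrix.mulVec, dotProduct]
      exact Finset.sum_congr rfl fun k _ => by rw [h2]
    have h5 := taylorCoeff_coord_mul i (i :: L) W.det
    rw [h3, map_sum, List.erase_cons_head, List.count_cons_self, hL] at h5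
    rw [Finset.sum_eq_zero] at h5
    · exact (mul_eq_zero.1 h5.symm).resolve_left (Nat.cast_ne_zero.2 (Nat.succ_ne_zero _))
    · intro k _
      split_ifs with hk
      · simp
      · rw [mul_comm, taylorCoeff_coord_pow_mul]
        rw [List.count_cons_of_ne (Ne.symm hk)]
        exact hlt k
  let C : Matrix (Fin n) (Fin n) (AnalyticGerm (0 : Fin n → ℂ)) :=
    Matrix.diagonal fun i => coord 0 i ^ (N - 1)
  have hC : ∀ i, C i ⬝ᵥ coord 0 = coord 0 i ^ N := by
    intro i
    have := Matrix.mulVec_diagonal (fun i => (coord 0 i : AnalyticGerm (0 : Fin n → ℂ)) ^ (N - 1))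
      (coord 0) i
    rw [Matrix.mulVec] at this
    rw [this, ← pow_succ, Nat.sub_add_cancel (Nat.pos_of_ne_zero hN)]
  have hall : ∀ s : Finset (Fin n), ∃ V : Matrix (Fin n) (Fin n) (AnalyticGerm (0 : Fin n → ℂ)),
      V.mulVec (coord 0) = (fun i => coord 0 i ^ N) ∧ (∀ i ∈ s, V i = C i) ∧
      taylorCoeff L V.det = taylorCoeff L U.det := by
    intro s
    induction s using Finset.induction_on with
    | empty => exact ⟨U, hU, by simp, rfl⟩
    | insert a s ha ih =>
      obtain ⟨V, hV, hVs, hVU⟩ := ih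
      refine ⟨V.updateRow a (C a), ?_, ?_, (hrow V a (C a) hV (hC a)).trans hVU⟩
      · funext k
        by_cases hk : k = a
        · subst hk
          rw [Matrix.mulVec, Matrix.updateRow_self, hC]
        · rw [Matrix.mulVec, Matrix.updateRow_ne hk]
          exact congrFun hV k
      · intro i hi
        by_cases hia : i = a
        · subst hia
          rw [Matrix.updateRow_self]
        · rw [Matrix.updateRow_ne hia]
          exact hVs i ((Finset.mem_insert.1 hi).resolve_left hia)
  intro hmem
  obtain ⟨V, -, hVC, hVU⟩ := hall Finset.univ
  have hV : V = C := funext fun i => hVC i (Finset.mem_univ i)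
  rw [taylorCoeff_eq_zero_of_mem_span hlt hmem, hV, Matrix.det_diagonal, Finset.prod_pow] at hVU
  have hprod : (L.map (coord 0)).prod =
      (∏ i, (coord 0 i : AnalyticGerm (0 : Fin n → ℂ))) ^ (N - 1) := by
    rw [← Multiset.prod_coe, ← Multiset.map_coe, Multiset.coe_toList, Multiset.map_nsmul,
      Multiset.prod_nsmul]
    rfl
  rw [← hprod] at hVU
  exact taylorCoeff_prod_ne_zero L L (List.Perm.refl L) hVU

/-- If the components of `T x` generate an ideal that contains a power of every variable, then
`det T` is not in this ideal. -/
theorem det_notMem_span {P : Fin n → AnalyticGerm (0 : Fin n → ℂ)} {N : ℕ}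
    (hN : ∀ i, coord 0 i ^ N ∈ Ideal.span (Set.range P))
    {T : Matrix (Fin n) (Fin n) (AnalyticGerm (0 : Fin n → ℂ))} (hT : T.mulVec (coord 0) = P) :
    T.det ∉ Ideal.span (Set.range P) := by
  -- The exponent is raised by one because `N` may be `0`, which `det_notMem_span_coord_pow`
  -- excludes.
  have hN' : ∀ i, coord 0 i ^ (N + 1) ∈ Ideal.span (Set.range P) := fun i => by
    rw [pow_succ]
    exact Ideal.mul_mem_right _ _ (hN i)
  choose S hS using fun i => Ideal.mem_span_range_iff_exists_fun.1 (hN' i)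
  let S' : Matrix (Fin n) (Fin n) (AnalyticGerm (0 : Fin n → ℂ)) := Matrix.of S
  have hS' : S'.mulVec P = fun i => coord 0 i ^ (N + 1) := funext hS
  intro hmem
  refine det_notMem_span_coord_pow (Nat.succ_ne_zero N) (S' * T)
    (by rw [← Matrix.mulVec_mulVec, hT, hS']) ?_
  -- By Cramer's rule `det S'` carries `(P)` into the ideal of powers, so `det T ∈ (P)` would put
  -- `det (S' * T)` there.
  have hdet : ∀ j, S'.det * P j ∈
      Ideal.span (Set.range fun i => (coord 0 i : AnalyticGerm (0 : Fin n → ℂ)) ^ (N + 1)) := by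
    intro j
    have h4 := congrFun (congrArg (fun M => Matrix.mulVec M P) (Matrix.adjugate_mul S')) j
    simp only [← Matrix.mulVec_mulVec, Matrix.smul_mulVec, Matrix.one_mulVec, Pi.smul_apply,
      smul_eq_mul, hS'] at h4
    rw [← h4, Matrix.mulVec, dotProduct]
    exact sum_mem fun i _ => Ideal.mul_mem_left _ _ (Ideal.subset_span (Set.mem_range_self i))
  obtain ⟨a, ha⟩ := Ideal.mem_span_range_iff_exists_fun.1 hmem
  rw [Matrix.det_mul, ← ha, Finset.mul_sum]
  refine sum_mem fun j _ => ?_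
  rw [mul_left_comm]
  exact Ideal.mul_mem_left _ _ (hdet j)

end Taylor

/-! ### The socle of the local algebra of an isolated zero -/

section LocalAlgebra

variable {n : ℕ}

/-- Polynomials as germs at `0`. -/
def polyToGerm (n : ℕ) : MvPolynomial (Fin n) ℂ →ₐ[ℂ] AnalyticGerm (0 : Fin n → ℂ) :=
  MvPolynomial.aeval (coord 0)

theorem pderiv_polyToGerm (j : Fin n) (p : MvPolynomial (Fin n) ℂ) :
    pderiv j (polyToGerm n p) = polyToGerm n (MvPolynomial.pderiv j p) := by
  induction p using MvPolynomial.induction_on with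
  | C c => simp [polyToGerm]
  | add p q hp hq => rw [map_add, pderiv_add, hp, hq, map_add, map_add]
  | mul_X p i hp =>
    have hX : polyToGerm n (MvPolynomial.X i) = coord 0 i := MvPolynomial.aeval_X _ _
    rw [map_mul, pderiv_mul, hp, hX, MvPolynomial.pderiv_mul, MvPolynomial.pderiv_X, map_add,
      map_mul, map_mul, hX, pderiv_coord]
    by_cases h : i = j
    · subst h
      simp
      ring
    · simp [h, mul_comm]

theorem exists_sub_polyToGerm_mem (k : ℕ) (g : AnalyticGerm (0 : Fin n → ℂ)) :
    ∃ p, g - polyToGerm n p ∈ vanishingIdeal (0 : Fin n → ℂ) ^ k := by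
  induction k generalizing g with
  | zero => exact ⟨0, by simp⟩
  | succ k ih =>
    have h1 : g - algebraMap ℂ _ (evalHom 0 g) ∈ vanishingIdeal (0 : Fin n → ℂ) := by
      rw [mem_vanishingIdeal]
      simp
    rw [vanishingIdeal_zero_eq_span] at h1
    obtain ⟨a, ha⟩ := Ideal.mem_span_range_iff_exists_fun.1 h1
    choose p hp using fun i => ih (a i)
    refine ⟨MvPolynomial.C (evalHom 0 g) + ∑ i, p i * MvPolynomial.X i, ?_⟩
    have h2 : g - polyToGerm n (MvPolynomial.C (evalHom 0 g) + ∑ i, p i * MvPolynomial.X i) =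
        ∑ i, (a i - polyToGerm n (p i)) * coord 0 i := by
      simp only [sub_mul, Finset.sum_sub_distrib, ha]
      simp [polyToGerm]
      ring
    rw [h2, pow_succ]
    refine sum_mem fun i _ => Ideal.mul_mem_mul (hp i) ?_
    rw [mem_vanishingIdeal, evalHom_coord]
    rfl

/-- If `0` is the only zero of the ideal `(G₁, …, Gₙ)` in `n` variables, then the socle of
`𝓞 / (G₁, …, Gₙ)` is generated by the Jacobian determinant. -/
theorem mem_socle_iff_mem_sup_jacobian (G : Fin n → AnalyticGerm (0 : Fin n → ℂ))
    (hG : ∀ i, G i ∈ vanishingIdeal 0)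
    (hrad : vanishingIdeal 0 ≤ (Ideal.span (Set.range G)).radical)
    (s : AnalyticGerm (0 : Fin n → ℂ)) :
    (∀ a ∈ vanishingIdeal 0, s * a ∈ Ideal.span (Set.range G)) ↔
      s ∈ Ideal.span (Set.range G) ⊔ Ideal.span {(Matrix.of fun i j => pderiv j (G i)).det} := by
  set I := Ideal.span (Set.range G) with hI
  have hGI : ∀ i, G i ∈ I := fun i => Ideal.subset_span (Set.mem_range_self i)
  have hIle : I ≤ vanishingIdeal 0 := Ideal.span_le.2 (by rintro _ ⟨i, rfl⟩; exact hG i)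
  have hfg : (vanishingIdeal (0 : Fin n → ℂ)).FG := by
    rw [vanishingIdeal_zero_eq_span]
    exact Submodule.fg_span (Set.finite_range _)
  obtain ⟨N, hN⟩ := Ideal.exists_pow_le_of_le_radical_of_fg hrad hfg
  -- polynomial generators of the ideal
  choose P hP using fun i => exists_sub_polyToGerm_mem (N + 1) (G i)
  -- Approximation to order `N + 1`, one more than needed to land in `I`, puts the error in `𝔪 I`.
  -- Thus `P = (1 - e) G` with `e` vanishing at `0`, an invertible change of generators.
  have hPe : ∀ i, ∃ e : Fin n → AnalyticGerm (0 : Fin n → ℂ),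
      (∀ j, e j ∈ vanishingIdeal 0) ∧ G i - polyToGerm n (P i) = ∑ j, e j * G j := by
    intro i
    have h1 : G i - polyToGerm n (P i) ∈ vanishingIdeal (0 : Fin n → ℂ) • I := by
      refine Ideal.mul_mono_right hN ?_
      rw [← pow_succ']
      exact hP i
    obtain ⟨a, ha, h2⟩ := (Submodule.mem_ideal_smul_span_iff_exists_sum _ _ _).1 h1
    refine ⟨a, ha, h2.symm.trans ?_⟩
    exact Finsupp.sum_fintype _ _ fun _ => zero_smul _ _
  choose e he hPe using hPe
  let A : Matrix (Fin n) (Fin n) (AnalyticGerm (0 : Fin n → ℂ)) := 1 - Matrix.of e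
  have hA : A.mulVec G = fun i => polyToGerm n (P i) := by
    funext i
    rw [Matrix.sub_mulVec, Matrix.one_mulVec, Pi.sub_apply]
    have : (Matrix.of e).mulVec G i = ∑ j, e i j * G j := rfl
    rw [this, ← hPe i, sub_sub_cancel]
  have hAunit : IsUnit A.det := by
    refine isUnit_of_evalHom_ne_zero ?_
    rw [AlgHom.map_det]
    have : (evalHom 0).mapMatrix A = 1 := by
      ext i j
      have h0 : evalHom 0 (e i j) = 0 := he i j
      simp only [A, AlgHom.mapMatrix_apply, Matrix.map_apply, Matrix.sub_apply, Matrix.of_apply,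
        map_sub, h0, sub_zero, Matrix.one_apply]
      split_ifs <;> simp
    rw [this, Matrix.det_one]
    exact one_ne_zero
  have hPI : ∀ i, polyToGerm n (P i) ∈ I := by
    intro i
    rw [← congrFun hA i, Matrix.mulVec, dotProduct]
    exact sum_mem fun j _ => Ideal.mul_mem_left _ _ (hGI j)
  have hspan : Ideal.span (Set.range fun i => polyToGerm n (P i)) = I := by
    refine le_antisymm (Ideal.span_le.2 (by rintro _ ⟨i, rfl⟩; exact hPI i))
      (Ideal.span_le.2 ?_)
    rintro _ ⟨i, rfl⟩
    have h1 : G = A⁻¹.mulVec fun i => polyToGerm n (P i) := by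
      rw [← hA, Matrix.mulVec_mulVec, Matrix.nonsing_inv_mul _ hAunit, Matrix.one_mulVec]
    rw [congrFun h1 i, Matrix.mulVec, dotProduct]
    exact sum_mem fun j _ => Ideal.mul_mem_left _ _ (Ideal.subset_span (Set.mem_range_self j))
  -- the quotient algebra
  let π : MvPolynomial (Fin n) ℂ →ₐ[ℂ] AnalyticGerm (0 : Fin n → ℂ) ⧸ I :=
    (Ideal.Quotient.mkₐ ℂ I).comp (polyToGerm n)
  have hπ : Function.Surjective π := by
    intro q
    obtain ⟨g, rfl⟩ := Ideal.Quotient.mk_surjective q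
    obtain ⟨p, hp⟩ := exists_sub_polyToGerm_mem N g
    exact ⟨p, (Ideal.Quotient.eq.2 (hN hp)).symm⟩
  let ε : AnalyticGerm (0 : Fin n → ℂ) ⧸ I →ₐ[ℂ] ℂ := Ideal.Quotient.liftₐ I (evalHom 0) hIle
  have hεmk : ∀ g, ε (Ideal.Quotient.mk I g) = evalHom 0 g := fun g => rfl
  have hnil : ∀ a, ε a = 0 → IsNilpotent a := by
    intro a ha
    obtain ⟨g, rfl⟩ := Ideal.Quotient.mk_surjective a
    refine ⟨N, ?_⟩
    rw [← map_pow, Ideal.Quotient.eq_zero_iff_mem]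
    exact hN (Ideal.pow_mem_pow ha N)
  -- Every element is a scalar plus a nilpotent, hence integral; an integral algebra of finite type
  -- is finite.
  have hfin : FiniteDimensional ℂ (AnalyticGerm (0 : Fin n → ℂ) ⧸ I) := by
    have h1 : Algebra.FiniteType ℂ (AnalyticGerm (0 : Fin n → ℂ) ⧸ I) :=
      Algebra.FiniteType.of_surjective π hπ
    have h2 : Algebra.IsIntegral ℂ (AnalyticGerm (0 : Fin n → ℂ) ⧸ I) := by
      refine ⟨fun a => ?_⟩
      obtain ⟨k, hk⟩ := hnil (a - algebraMap ℂ _ (ε a)) (by simp)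
      have h3 : IsIntegral ℂ (a - algebraMap ℂ _ (ε a)) := by
        refine IsIntegral.of_pow (n := k + 1) (Nat.succ_pos k) ?_
        rw [pow_succ, hk, zero_mul]
        exact isIntegral_zero
      have h4 := h3.add (isIntegral_algebraMap (x := ε a))
      rwa [sub_add_cancel] at h4
    exact Algebra.IsIntegral.finite
  have hdet : ∀ T : Matrix (Fin n) (Fin n) (MvPolynomial (Fin n) ℂ),
      (∀ i, P i = ∑ j, T i j * MvPolynomial.X j) → π T.det ≠ 0 := by
    intro T hT h0
    have h1 : polyToGerm n T.det ∈ I := Ideal.Quotient.eq_zero_iff_mem.1 h0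
    rw [AlgHom.map_det, ← hspan] at h1
    refine det_notMem_span (N := N) (fun i => ?_) ?_ h1
    · rw [hspan]
      refine hN (Ideal.pow_mem_pow ?_ N)
      rw [mem_vanishingIdeal, evalHom_coord]
      rfl
    · funext i
      rw [hT i, map_sum, Matrix.mulVec, dotProduct]
      refine Finset.sum_congr rfl fun j _ => ?_
      rw [map_mul]
      congr 1
      exact (MvPolynomial.aeval_X _ _).symm
  have hsocle := socle_eq_span_jacobian π hπ ε (fun j => by
    have : polyToGerm n (MvPolynomial.X j) = coord 0 j := MvPolynomial.aeval_X _ _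
    simp [π, this, hεmk]) hnil P (fun i => Ideal.Quotient.eq_zero_iff_mem.2 (hPI i)) hdet
    (Ideal.Quotient.mk I s)
  -- comparison of the Jacobian determinants
  have hJ : π (Matrix.of fun i j => MvPolynomial.pderiv j (P i)).det =
      Ideal.Quotient.mk I (A.det * (Matrix.of fun i j => pderiv j (G i)).det) := by
    rw [← Matrix.det_mul, AlgHom.map_det, RingHom.map_det]
    congr 1
    ext i j
    change Ideal.Quotient.mk I (polyToGerm n (MvPolynomial.pderiv j (P i))) =
      Ideal.Quotient.mk I ((A * Matrix.of fun i j => pderiv j (G i)) i j)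
    rw [← pderiv_polyToGerm, ← congrFun hA i, Matrix.mulVec, dotProduct, ← pderivation_apply,
      map_sum, Matrix.mul_apply, Ideal.Quotient.eq, ← Finset.sum_sub_distrib]
    -- In the derivative of `A G`, the terms that differentiate `A` carry a factor `G l ∈ I` and
    -- drop out.
    refine sum_mem fun l _ => ?_
    rw [pderivation_apply, pderiv_mul, Matrix.of_apply, add_sub_cancel_left]
    exact Ideal.mul_mem_right _ _ (hGI l)
  rw [hJ] at hsocle
  obtain ⟨u, hu⟩ := hAunit
  constructor
  · intro hs
    obtain ⟨c, hc⟩ := hsocle.1 fun a ha => by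
      obtain ⟨g, rfl⟩ := Ideal.Quotient.mk_surjective a
      rw [← map_mul, Ideal.Quotient.eq_zero_iff_mem]
      exact hs g ha
    obtain ⟨c, rfl⟩ := Ideal.Quotient.mk_surjective c
    rw [← map_mul, Ideal.Quotient.eq] at hc
    rw [← sub_add_cancel s (c * (A.det * (Matrix.of fun i j => pderiv j (G i)).det))]
    refine add_mem (Ideal.mem_sup_left hc) (Ideal.mem_sup_right ?_)
    rw [← mul_assoc]
    exact Ideal.mul_mem_left _ _ (Ideal.mem_span_singleton_self _)
  · intro hs a ha
    obtain ⟨t, ht, c, hc, rfl⟩ := Submodule.mem_sup.1 hs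
    obtain ⟨c, rfl⟩ := Ideal.mem_span_singleton'.1 hc
    rw [← Ideal.Quotient.eq_zero_iff_mem, map_mul]
    refine hsocle.2 ⟨Ideal.Quotient.mk I (c * ↑u⁻¹), ?_⟩ _ ha
    rw [← map_mul, Ideal.Quotient.eq, ← hu]
    have : c * (↑u⁻¹ : AnalyticGerm (0 : Fin n → ℂ)) *
        (↑u * (Matrix.of fun i j => pderiv j (G i)).det) =
        c * (Matrix.of fun i j => pderiv j (G i)).det := by
      rw [mul_assoc, Units.inv_mul_cancel_left]
    rw [this, add_sub_cancel_right]
    exact ht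

end LocalAlgebra

/-! ### Restriction of germs to the hypersurface -/

section Restriction

theorem pderiv_zero_tailPullback {n : ℕ} (g : AnalyticGerm (0 : Fin n → ℂ)) :
    pderiv 0 (tailPullback n g) = 0 := by
  rw [tailPullback, pderiv_pullback]
  refine Finset.sum_eq_zero fun j _ => ?_
  have h : pullback (fun (z : Fin (n + 1) → ℂ) (i : Fin n) => z i.succ)
      (AnalyticAt.pi fun _ => analyticAt_apply _) rfl (coord (0 : Fin n → ℂ) j) =
      coord (0 : Fin (n + 1) → ℂ) j.succ := rfl
  rw [h, pderiv_coord, if_neg (Fin.succ_ne_zero j), mul_zero]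

variable {m : ℕ} {f : LaurentPoly (m + 1)} {z₀ : regularLocus f} (ψ : LocalCoords f z₀)

namespace LocalCoords

theorem isGermOf_restrict {g : AnalyticGerm z₀.1} {G : (Fin (m + 1) → ℂ) → ℂ}
    (hg : IsGermOf g G) : IsGermOf (ψ.restrict g) fun x => G (ψ.param x) :=
  hg.pullback ψ.analyticAt ψ.param_zero

theorem evalHom_restrict (g : AnalyticGerm z₀.1) : evalHom 0 (ψ.restrict g) = evalHom z₀.1 g :=
  evalHom_pullback ψ.analyticAt ψ.param_zero g

theorem restrict_polyGerm : ψ.restrict (polyGerm f z₀) = 0 := by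
  refine ((ψ.isGermOf_restrict (isGermOf_germOf _)).eq_iff isGermOf_zero).2 ?_
  filter_upwards [ψ.eventually_mem] with x hx
  exact hx.2

/-- The Jacobian matrix of the parametrization. -/
def jac (j : Fin (m + 1)) (k : Fin m) : AnalyticGerm (0 : Fin m → ℂ) :=
  pderiv k (ψ.restrict (coord z₀.1 j))

theorem pderiv_restrict (g : AnalyticGerm z₀.1) (k : Fin m) :
    pderiv k (ψ.restrict g) = ∑ j, ψ.restrict (pderiv j g) * ψ.jac j k :=
  pderiv_pullback ψ.analyticAt ψ.param_zero g k

theorem sum_restrict_pderiv_mul_jac (k : Fin m) :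
    ∑ j, ψ.restrict (pderiv j (polyGerm f z₀)) * ψ.jac j k = 0 := by
  rw [← pderiv_restrict, restrict_polyGerm]
  exact map_zero (pderivation k)

theorem evalHom_jac (j : Fin (m + 1)) (k : Fin m) :
    evalHom 0 (ψ.jac j k) = fderiv ℂ ψ.param 0 (Pi.single k 1) j := by
  rw [jac, ((ψ.isGermOf_restrict (isGermOf_coord j)).pderiv k).evalHom_eq, partialDeriv,
    fderiv_apply ψ.analyticAt.differentiableAt]
  rfl

theorem evalHom_pderiv_polyGerm (j : Fin (m + 1)) :
    evalHom z₀.1 (pderiv j (polyGerm f z₀)) = partialDeriv j f.eval z₀.1 :=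
  ((isGermOf_germOf _).pderiv j).evalHom_eq

/-- The tangent vectors of the hypersurface are determined by the coordinates other than `i₀`. -/
theorem eq_zero_of_fderiv_param_eq {i₀ : Fin (m + 1)} (hi₀ : partialDeriv i₀ f.eval z₀.1 ≠ 0)
    {v : Fin m → ℂ} (hv : ∀ j, fderiv ℂ ψ.param 0 v (i₀.succAbove j) = 0) : v = 0 := by
  have hexp : ∀ j, fderiv ℂ ψ.param 0 v j = ∑ k, evalHom 0 (ψ.jac j k) * v k := by
    intro j
    conv_lhs => rw [pi_eq_sum_univ' v, map_sum, Finset.sum_apply]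
    refine Finset.sum_congr rfl fun k _ => ?_
    rw [map_smul, evalHom_jac, Pi.smul_apply, smul_eq_mul, mul_comm]
  -- The differential of `f` annihilates tangent vectors; since `∂f/∂z_{i₀} ≠ 0`, the component `i₀`
  -- vanishes with the others.
  have h1 : ∑ j, partialDeriv j f.eval z₀.1 * fderiv ℂ ψ.param 0 v j = 0 := by
    simp only [hexp, Finset.mul_sum]
    rw [Finset.sum_comm]
    refine Finset.sum_eq_zero fun k _ => ?_
    have h2 := congrArg (evalHom 0) (ψ.sum_restrict_pderiv_mul_jac k)
    simp only [map_sum, map_mul, map_zero, evalHom_restrict, evalHom_pderiv_polyGerm] at h2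
    calc _ = (∑ j, partialDeriv j f.eval z₀.1 * evalHom 0 (ψ.jac j k)) * v k := by
          rw [Finset.sum_mul]
          exact Finset.sum_congr rfl fun j _ => by ring
      _ = 0 := by rw [h2, zero_mul]
  rw [Fin.sum_univ_succAbove _ i₀] at h1
  simp only [hv, mul_zero, Finset.sum_const_zero, add_zero, mul_eq_zero, hi₀, false_or] at h1
  refine ψ.immersion ?_
  rw [map_zero]
  funext j
  rcases Fin.eq_self_or_eq_succAbove i₀ j with rfl | ⟨i, rfl⟩
  · exact h1
  · exact hv i

theorem isUnit_det_jac {i₀ : Fin (m + 1)} (hi₀ : partialDeriv i₀ f.eval z₀.1 ≠ 0) :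
    IsUnit (Matrix.of fun j k => ψ.jac (i₀.succAbove j) k).det := by
  refine isUnit_of_evalHom_ne_zero ?_
  rw [AlgHom.map_det]
  intro h
  obtain ⟨v, hv0, hv⟩ := Matrix.exists_mulVec_eq_zero_iff.2 h
  refine hv0 (ψ.eq_zero_of_fderiv_param_eq hi₀ fun j => ?_)
  have h1 := congrFun hv j
  rw [Matrix.mulVec, dotProduct] at h1
  simp only [AlgHom.mapMatrix_apply, Matrix.map_apply, Matrix.of_apply, evalHom_jac,
    Pi.zero_apply] at h1
  conv_lhs => rw [pi_eq_sum_univ' v, map_sum, Finset.sum_apply]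
  rw [← h1]
  refine Finset.sum_congr rfl fun k _ => ?_
  rw [map_smul, Pi.smul_apply, smul_eq_mul, mul_comm]

/-- The parametrization, extended by the coordinate direction `i₀`. -/
def extend (i₀ : Fin (m + 1)) (z : Fin (m + 1) → ℂ) : Fin (m + 1) → ℂ :=
  ψ.param (fun i => z i.succ) + z 0 • Pi.single i₀ 1

theorem extend_zero (i₀ : Fin (m + 1)) : ψ.extend i₀ 0 = z₀.1 := by
  have h : (fun i : Fin m => (0 : Fin (m + 1) → ℂ) i.succ) = 0 := rfl
  rw [extend, h, ψ.param_zero, Pi.zero_apply, zero_smul, add_zero]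

theorem extend_cons_zero (i₀ : Fin (m + 1)) (x : Fin m → ℂ) :
    ψ.extend i₀ (Fin.cons 0 x) = ψ.param x := by
  simp [extend]

theorem analyticAt_extend (i₀ : Fin (m + 1)) : AnalyticAt ℂ (ψ.extend i₀) 0 := by
  refine AnalyticAt.add (AnalyticAt.comp (g := ψ.param) ψ.analyticAt
    (AnalyticAt.pi fun _ => analyticAt_apply _)) ?_
  exact (analyticAt_apply 0).smul analyticAt_const

/-- The extended parametrization has a local inverse. -/
theorem exists_localInverse {i₀ : Fin (m + 1)} (hi₀ : partialDeriv i₀ f.eval z₀.1 ≠ 0) :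
    ∃ Θ : (Fin (m + 1) → ℂ) → (Fin (m + 1) → ℂ), AnalyticAt ℂ Θ z₀.1 ∧ Θ z₀.1 = 0 ∧
      (∀ᶠ w in 𝓝 0, Θ (ψ.extend i₀ w) = w) ∧ ∀ᶠ z in 𝓝 z₀.1, ψ.extend i₀ (Θ z) = z := by
  let P : (Fin (m + 1) → ℂ) →L[ℂ] (Fin m → ℂ) :=
    ContinuousLinearMap.pi fun i => ContinuousLinearMap.proj i.succ
  let D : (Fin (m + 1) → ℂ) →L[ℂ] (Fin (m + 1) → ℂ) := (fderiv ℂ ψ.param 0).comp P +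
    (ContinuousLinearMap.proj (R := ℂ) (φ := fun _ : Fin (m + 1) => ℂ) 0).smulRight (Pi.single i₀ 1)
  have hD : HasFDerivAt (ψ.extend i₀) D 0 := by
    have h1 : HasFDerivAt ψ.param (fderiv ℂ ψ.param 0) (P 0) := by
      rw [map_zero]
      exact ψ.analyticAt.differentiableAt.hasFDerivAt
    refine (h1.comp 0 P.hasFDerivAt).add ?_
    exact (ContinuousLinearMap.proj (R := ℂ) (φ := fun _ : Fin (m + 1) => ℂ)
      0).hasFDerivAt.smul_const _
  have hinj : Function.Injective D := by
    rw [injective_iff_map_eq_zero]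
    intro v hv
    have h1 : P v = 0 := by
      refine ψ.eq_zero_of_fderiv_param_eq hi₀ fun j => ?_
      have := congrFun hv (i₀.succAbove j)
      simpa [D, Fin.succAbove_ne] using this
    have h2 : v 0 = 0 := by
      have := congrFun hv i₀
      simpa [D, h1] using this
    funext i
    refine Fin.cases h2 (fun i => ?_) i
    exact congrFun h1 i
  let e : (Fin (m + 1) → ℂ) ≃L[ℂ] (Fin (m + 1) → ℂ) :=
    (LinearEquiv.ofInjectiveOfFinrankEq D.toLinearMap hinj rfl).toContinuousLinearEquiv
  have he : (e : (Fin (m + 1) → ℂ) →L[ℂ] (Fin (m + 1) → ℂ)) = D := by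
    ext v
    rfl
  have ha := ψ.analyticAt_extend i₀
  have hd : HasStrictFDerivAt (ψ.extend i₀) (e : (Fin (m + 1) → ℂ) →L[ℂ] (Fin (m + 1) → ℂ)) 0 := by
    rw [he, ← hD.fderiv]
    exact ha.hasStrictFDerivAt
  let H := hd.toOpenPartialHomeomorph (ψ.extend i₀)
  have hH0 : (0 : Fin (m + 1) → ℂ) ∈ H.source := hd.mem_toOpenPartialHomeomorph_source
  have hHz : ψ.extend i₀ 0 ∈ H.target := H.map_source hH0
  have hS : AnalyticAt ℂ H.symm (ψ.extend i₀ 0) :=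
    H.analyticAt_symm' hH0 ha hd.hasFDerivAt.fderiv
  rw [extend_zero] at hS hHz
  refine ⟨H.symm, hS, ?_, ?_, ?_⟩
  · rw [← ψ.extend_zero i₀]
    exact H.left_inv hH0
  · filter_upwards [H.open_source.mem_nhds hH0] with w hw
    exact H.left_inv hw
  · filter_upwards [H.open_target.mem_nhds hHz] with z hz
    exact H.right_inv hz

theorem tendsto_cons_zero (m : ℕ) :
    Tendsto (fun x : Fin m → ℂ => (Fin.cons 0 x : Fin (m + 1) → ℂ)) (𝓝 0) (𝓝 0) := by
  have h := (analyticAt_cons_zero (0 : Fin m → ℂ)).continuousAt.tendsto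
  rwa [cons_zero_zero] at h

/-- In the coordinates `Θ` the hypersurface is `x₀ = 0`, and a germ on it extends constantly along
`x₀`. -/
theorem restrict_surjective : Function.Surjective ψ.restrict := by
  obtain ⟨i₀, hi₀⟩ := z₀.2.2
  obtain ⟨Θ, hΘ, hΘ0, hΘ1, -⟩ := ψ.exists_localInverse hi₀
  intro h
  obtain ⟨H, -, hH⟩ := exists_isGermOf h
  refine ⟨pullback Θ hΘ hΘ0 (tailPullback m h), ?_⟩
  refine ((ψ.isGermOf_restrict (hH.tailPullback.pullback hΘ hΘ0)).eq_iff hH).2 ?_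
  filter_upwards [(tendsto_cons_zero m).eventually hΘ1] with x hx
  rw [extend_cons_zero] at hx
  simp only [hx, Fin.cons_succ]

theorem eventually_param_eq_imp : ∀ᶠ x in 𝓝 0, ψ.param x = z₀.1 → x = 0 := by
  obtain ⟨i₀, hi₀⟩ := z₀.2.2
  obtain ⟨Θ, hΘ, hΘ0, hΘ1, -⟩ := ψ.exists_localInverse hi₀
  filter_upwards [(tendsto_cons_zero m).eventually hΘ1] with x hx hxz
  rw [extend_cons_zero, hxz, hΘ0] at hx
  funext i
  exact (congrFun hx i.succ).symm

/-- In the extended coordinates a germ that vanishes on the hypersurface is divisible by `x₀`. The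
germ of `f` is itself a unit times `x₀`: its `x₀`-derivative at `0` is `∂f/∂z_{i₀} ≠ 0`. -/
theorem ker_restrict_le : RingHom.ker ψ.restrict ≤ Ideal.span {polyGerm f z₀} := by
  obtain ⟨i₀, hi₀⟩ := z₀.2.2
  obtain ⟨Θ, hΘ, hΘ0, hΘ1, hΘ2⟩ := ψ.exists_localInverse hi₀
  let E : AnalyticGerm z₀.1 →ₐ[ℂ] AnalyticGerm (0 : Fin (m + 1) → ℂ) :=
    pullback (ψ.extend i₀) (ψ.analyticAt_extend i₀) (ψ.extend_zero i₀)
  have hE : ∀ g, hyperplaneRestrict m (E g) = ψ.restrict g := by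
    intro g
    obtain ⟨G, -, hg⟩ := exists_isGermOf g
    refine (((hg.pullback _ _).pullback _ _).eq_iff (ψ.isGermOf_restrict hg)).2
      (Eventually.of_forall fun x => ?_)
    simp only [extend_cons_zero]
  have hinv : ∀ g, pullback Θ hΘ hΘ0 (E g) = g := by
    intro g
    obtain ⟨G, -, hg⟩ := exists_isGermOf g
    refine (((hg.pullback _ _).pullback _ _).eq_iff hg).2 ?_
    filter_upwards [hΘ2] with z hz
    rw [hz]
  have hdiv : ∀ g, ψ.restrict g = 0 → ∃ q, E g = q * coord 0 0 := by
    intro g hg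
    obtain ⟨q, hq⟩ := exists_eq_mul_coord_zero_add (E g)
    refine ⟨q, ?_⟩
    rwa [hE, hg, map_zero, add_zero] at hq
  obtain ⟨u, hu⟩ := hdiv _ ψ.restrict_polyGerm
  have hunit : IsUnit u := by
    refine isUnit_of_evalHom_ne_zero ?_
    have h1 : evalHom 0 (pderiv 0 (E (polyGerm f z₀))) = evalHom 0 u := by
      rw [hu, pderiv_mul, pderiv_coord]
      simp
    have hEc : ∀ j, pderiv 0 (E (coord z₀.1 j)) = if j = i₀ then 1 else 0 := by
      intro j
      have h2 : E (coord z₀.1 j) = tailPullback m (ψ.restrict (coord z₀.1 j)) +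
          algebraMap ℂ _ (if j = i₀ then 1 else 0) * coord 0 0 := by
        refine (((isGermOf_coord j).pullback _ _).eq_iff
          ((ψ.isGermOf_restrict (isGermOf_coord j)).tailPullback.add
            ((isGermOf_algebraMap _).mul (isGermOf_coord 0)))).2 (Eventually.of_forall fun z => ?_)
        simp [extend, Pi.single_apply]
      rw [h2, pderiv_add, pderiv_zero_tailPullback, pderiv_mul, pderiv_coord, pderiv_algebraMap]
      by_cases h : j = i₀ <;> simp [h]
    have h3 : pderiv 0 (E (polyGerm f z₀)) = E (pderiv i₀ (polyGerm f z₀)) := by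
      rw [show pderiv 0 (E (polyGerm f z₀)) = ∑ j, E (pderiv j (polyGerm f z₀)) *
        pderiv 0 (E (coord z₀.1 j)) from pderiv_pullback _ _ _ _]
      simp [hEc]
    rw [← h1, h3]
    have h4 := evalHom_pullback (ψ.analyticAt_extend i₀) (ψ.extend_zero i₀)
      (pderiv i₀ (polyGerm f z₀))
    rw [evalHom_pderiv_polyGerm] at h4
    rw [h4]
    exact hi₀
  intro g hg
  obtain ⟨q, hq⟩ := hdiv g hg
  obtain ⟨u, rfl⟩ := hunit
  rw [Ideal.mem_span_singleton']
  refine ⟨pullback Θ hΘ hΘ0 (q * ↑u⁻¹), ?_⟩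
  conv_lhs => rw [← hinv (polyGerm f z₀)]
  rw [← map_mul, hu, ← mul_assoc, Units.inv_mul_cancel_right, ← hq, hinv]

end LocalCoords

end Restriction

/-! ### The two-row minors and the logarithmic tangent vectors -/

section Minors

variable {A : Type*} [CommRing A] {m : ℕ} {w y : Fin (m + 1) → A} {t : Fin (m + 1) → Fin m → A}
  {φ : Fin m → A}

theorem mul_eq_sum_minor_mul (hw : ∀ k, ∑ j, w j * t j k = 0) (hφ : ∀ k, ∑ j, y j * t j k = φ k)
    (i : Fin (m + 1)) (k : Fin m) : w i * φ k = ∑ j, (w i * y j - w j * y i) * t j k := by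
  have h : ∑ j, (w i * y j - w j * y i) * t j k =
      w i * ∑ j, y j * t j k - y i * ∑ j, w j * t j k := by
    rw [Finset.mul_sum, Finset.mul_sum, ← Finset.sum_sub_distrib]
    exact Finset.sum_congr rfl fun j _ => by ring
  rw [h, hw, hφ, mul_zero, sub_zero]

/-- For `i = i₀` the relations `mul_eq_sum_minor_mul` form a square linear system for the minors of
row `i₀`, solved by inverting the block of `t`. Invertibility of `C` is what later exhibits the
Hessian as a unit multiple of a Jacobian minor. -/
theorem exists_matrix_minor_eq (hw : ∀ k, ∑ j, w j * t j k = 0)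
    (hφ : ∀ k, ∑ j, y j * t j k = φ k) {i₀ : Fin (m + 1)} (hi₀ : IsUnit (w i₀))
    (ht : IsUnit (Matrix.of fun j k => t (i₀.succAbove j) k).det) :
    ∃ C : Matrix (Fin m) (Fin m) A, IsUnit C.det ∧
      ∀ j, w i₀ * y (i₀.succAbove j) - w (i₀.succAbove j) * y i₀ = ∑ l, C j l * φ l := by
  set T : Matrix (Fin m) (Fin m) A := Matrix.of fun j k => t (i₀.succAbove j) k with hT
  refine ⟨w i₀ • (T⁻¹).transpose, ?_, fun j => ?_⟩
  · rw [Matrix.det_smul, Matrix.det_transpose]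
    exact (hi₀.pow _).mul (Matrix.isUnit_nonsing_inv_det _ ht)
  · let e : Fin m → A := fun j => w i₀ * y (i₀.succAbove j) - w (i₀.succAbove j) * y i₀
    have h1 : Matrix.vecMul e T = fun k => w i₀ * φ k := by
      funext k
      rw [mul_eq_sum_minor_mul hw hφ, Fin.sum_univ_succAbove _ i₀, sub_self, zero_mul, zero_add]
      rfl
    have h2 : e = Matrix.vecMul (fun k => w i₀ * φ k) T⁻¹ := by
      rw [← h1, Matrix.vecMul_vecMul, Matrix.mul_nonsing_inv _ ht, Matrix.vecMul_one]
    refine (congrFun h2 j).trans ?_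
    rw [Matrix.vecMul, dotProduct]
    refine Finset.sum_congr rfl fun l _ => ?_
    simp only [Matrix.smul_apply, Matrix.transpose_apply, smul_eq_mul]
    ring

theorem minor_mem_span (hw : ∀ k, ∑ j, w j * t j k = 0)
    (hφ : ∀ k, ∑ j, y j * t j k = φ k) {i₀ : Fin (m + 1)} (hi₀ : IsUnit (w i₀))
    (ht : IsUnit (Matrix.of fun j k => t (i₀.succAbove j) k).det) (i j : Fin (m + 1)) :
    w i * y j - w j * y i ∈ Ideal.span (Set.range φ) := by
  obtain ⟨C, -, hC⟩ := exists_matrix_minor_eq hw hφ hi₀ ht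
  have h : ∀ j, w i₀ * y j - w j * y i₀ ∈ Ideal.span (Set.range φ) := by
    intro j
    rcases Fin.eq_self_or_eq_succAbove i₀ j with rfl | ⟨l, rfl⟩
    · rw [sub_self]
      exact zero_mem _
    · rw [hC]
      exact sum_mem fun l _ => Ideal.mul_mem_left _ _ (Ideal.subset_span (Set.mem_range_self l))
  rw [← Ideal.unit_mul_mem_iff_mem _ hi₀]
  -- A Plücker-type relation reduces an arbitrary minor to those containing `i₀`.
  have h' : w i₀ * (w i * y j - w j * y i) =
      w i * (w i₀ * y j - w j * y i₀) - w j * (w i₀ * y i - w i * y i₀) := by ring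
  rw [h']
  exact sub_mem (Ideal.mul_mem_left _ _ (h j)) (Ideal.mul_mem_left _ _ (h i))

end Minors

/-! ### Quotients along a surjective homomorphism -/

theorem exists_quotient_algEquiv {A B : Type*} [CommRing A] [CommRing B] [Algebra ℂ A]
    [Algebra ℂ B] (R : B →ₐ[ℂ] A) (hR : Function.Surjective R) {K : Ideal B} {I : Ideal A}
    (h : K = I.comap R) :
    ∃ e : (B ⧸ K) ≃ₐ[ℂ] (A ⧸ I), ∀ g, e (Ideal.Quotient.mk K g) = Ideal.Quotient.mk I (R g) := by
  have hs : Function.Surjective ((Ideal.Quotient.mkₐ ℂ I).comp R) :=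
    (Ideal.Quotient.mkₐ_surjective ℂ I).comp hR
  have hk : K = RingHom.ker ((Ideal.Quotient.mkₐ ℂ I).comp R) := by
    rw [h]
    ext g
    rw [Ideal.mem_comap, RingHom.mem_ker, AlgHom.comp_apply, Ideal.Quotient.mkₐ_eq_mk,
      Ideal.Quotient.eq_zero_iff_mem]
  subst hk
  exact ⟨Ideal.quotientKerAlgEquivOfSurjective hs, fun g => rfl⟩

theorem eq_comap_of_map_eq {A B : Type*} [CommRing A] [CommRing B] [Algebra ℂ A]
    [Algebra ℂ B] {R : B →ₐ[ℂ] A} (hR : Function.Surjective R) {K : Ideal B} {I : Ideal A}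
    (hk : RingHom.ker R ≤ K) (h : K.map R = I) : K = I.comap R := by
  rw [← h, Ideal.comap_map_of_surjective' R hR]
  exact (sup_eq_left.2 hk).symm

/-! ### Determinants modulo an ideal -/

section Determinants

variable {A B : Type*} [CommRing A] [CommRing B] {m : ℕ}

/-- The matrix on the left is `(u | C)` times the block matrix `diag(1, H)`. -/
theorem det_mul_blockDiagonal (u : Fin (m + 1) → A) (C : Matrix (Fin (m + 1)) (Fin m) A)
    (H : Matrix (Fin m) (Fin m) A) :
    (Matrix.of fun i => (Fin.cons (u i) fun k => ∑ l, C i l * H l k : Fin (m + 1) → A)).det =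
      (Matrix.of fun i => (Fin.cons (u i) (C i) : Fin (m + 1) → A)).det * H.det := by
  let D : Matrix (Fin (m + 1)) (Fin (m + 1)) A :=
    Matrix.of (Fin.cons (Fin.cons 1 0) fun l => Fin.cons 0 (H l))
  have hD : D.det = H.det := by
    rw [Matrix.det_succ_row_zero, Fin.sum_univ_succ]
    simp [D, Matrix.submatrix]
    rfl
  rw [← hD, ← Matrix.det_mul]
  congr 1
  ext i k
  rw [Matrix.mul_apply, Fin.sum_univ_succ]
  refine Fin.cases ?_ (fun k => ?_) k <;> simp [D]

theorem det_sub_det_mem (I : Ideal A) {n : ℕ} {M N : Matrix (Fin n) (Fin n) A}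
    (h : ∀ i j, M i j - N i j ∈ I) : M.det - N.det ∈ I := by
  rw [← Ideal.Quotient.eq, RingHom.map_det, RingHom.map_det]
  congr 1
  ext i j
  exact Ideal.Quotient.eq.2 (h i j)

theorem det_cons_single (i₀ : Fin (m + 1)) (J : Matrix (Fin (m + 1)) (Fin m) A)
    (hJ : IsUnit (Matrix.of fun j k => J (i₀.succAbove j) k).det) :
    IsUnit (Matrix.of fun j => (Fin.cons (if j = i₀ then 1 else 0) (J j) :
      Fin (m + 1) → A)).det := by
  rw [Matrix.det_succ_column_zero, Finset.sum_eq_single i₀]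
  · simp only [Matrix.of_apply, Fin.cons_zero, if_true, mul_one]
    refine ((isUnit_one.neg).pow _).mul ?_
    exact hJ
  · intro j _ hj
    simp [hj]
  · simp

end Determinants

/-! ### The fibre of the logarithmic Gauss map in local coordinates -/

section Fiber

/-- Differentiating `exp (log w) = w` gives `w log' w = 1` for every branch. -/
theorem pderiv_logForm_mul_coord {n : ℕ} {z₀ : Fin n → ℂ} (y : Fin n → ℂ) (L : LogBranch z₀)
    (j : Fin n) :
    pderiv j (logForm y L) * coord z₀ j = algebraMap ℂ (AnalyticGerm z₀) (y j) := by
  refine ((((isGermOf_germOf _).pderiv j).mul (isGermOf_coord j)).eq_iff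
    (isGermOf_algebraMap _)).2 ?_
  have h1 : ∀ᶠ z in 𝓝 z₀, ∀ i, ∀ᶠ w in 𝓝 (z i), Complex.exp (L.log i w) = w :=
    eventually_all.2 fun i =>
      (continuous_apply i).continuousAt.eventually (L.exp_log i).eventually_nhds
  have h2 : ∀ᶠ z in 𝓝 z₀, ∀ i, AnalyticAt ℂ (L.log i) (z i) :=
    eventually_all.2 fun i =>
      (continuous_apply i).continuousAt.eventually (L.analyticAt i).eventually_analyticAt
  filter_upwards [h1, h2] with z hz hz'
  have hd : ∀ i, HasDerivAt (L.log i) (deriv (L.log i) (z i)) (z i) := fun i =>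
    (hz' i).differentiableAt.hasDerivAt
  have hlog : ∀ i, z i * deriv (L.log i) (z i) = 1 := by
    intro i
    have h3 := ((hd i).cexp.congr_of_eventuallyEq
      (EventuallyEq.symm (hz i))).unique (hasDerivAt_id' (z i))
    rwa [(hz i).self_of_nhds] at h3
  have hf : HasFDerivAt (fun z : Fin n → ℂ => ∑ i, y i * L.log i (z i))
      (∑ i, y i • (deriv (L.log i) (z i) •
        ContinuousLinearMap.proj (R := ℂ) (φ := fun _ : Fin n => ℂ) i)) z := by
    refine HasFDerivAt.fun_sum fun i _ => HasFDerivAt.const_mul ?_ _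
    exact (hd i).comp_hasFDerivAt z (ContinuousLinearMap.proj (R := ℂ) (φ := fun _ : Fin n => ℂ)
      i).hasFDerivAt
  rw [partialDeriv, hf.fderiv]
  have h4 := hlog j
  simp only [sum_apply, smul_apply, ContinuousLinearMap.proj_apply, Pi.single_apply, smul_eq_mul,
    mul_ite, mul_one, mul_zero, Finset.sum_ite_eq', Finset.mem_univ, if_true]
  linear_combination y j * h4

variable {m : ℕ} {f : LaurentPoly (m + 1)} {z₀ : regularLocus f} (ψ : LocalCoords f z₀)
  (y : Fin (m + 1) → ℂ) (L : LogBranch z₀.1)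

namespace LocalCoords

/-- The Jacobian matrix of the logarithm of the parametrization. -/
def logJac (j : Fin (m + 1)) (k : Fin m) : AnalyticGerm (0 : Fin m → ℂ) :=
  Ring.inverse (ψ.restrict (coord z₀.1 j)) * ψ.jac j k

/-- The restriction of the logarithmic derivative `zⱼ ∂f/∂zⱼ` to the hypersurface. -/
def logDeriv (j : Fin (m + 1)) : AnalyticGerm (0 : Fin m → ℂ) :=
  ψ.restrict (coord z₀.1 j * pderiv j (polyGerm f z₀))

theorem isUnit_restrict_coord (j : Fin (m + 1)) : IsUnit (ψ.restrict (coord z₀.1 j)) := by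
  refine isUnit_of_evalHom_ne_zero ?_
  rw [evalHom_restrict]
  exact z₀.2.1.1 j

theorem evalHom_logDeriv (j : Fin (m + 1)) :
    evalHom 0 (ψ.logDeriv j) = z₀.1 j * partialDeriv j f.eval z₀.1 := by
  rw [logDeriv, evalHom_restrict, map_mul, evalHom_pderiv_polyGerm, evalHom_coord]

theorem isUnit_logDeriv {i₀ : Fin (m + 1)} (hi₀ : partialDeriv i₀ f.eval z₀.1 ≠ 0) :
    IsUnit (ψ.logDeriv i₀) := by
  refine isUnit_of_evalHom_ne_zero ?_
  rw [evalHom_logDeriv]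
  exact mul_ne_zero (z₀.2.1.1 i₀) hi₀

theorem isUnit_det_logJac {i₀ : Fin (m + 1)} (hi₀ : partialDeriv i₀ f.eval z₀.1 ≠ 0) :
    IsUnit (Matrix.of fun j k => ψ.logJac (i₀.succAbove j) k).det := by
  have h := Matrix.det_mul_column
    (fun j => Ring.inverse (ψ.restrict (coord z₀.1 (i₀.succAbove j))))
    (Matrix.of fun j k => ψ.jac (i₀.succAbove j) k)
  have h' : (Matrix.of fun j k => ψ.logJac (i₀.succAbove j) k).det = _ := h
  rw [h']
  refine IsUnit.mul ?_ (ψ.isUnit_det_jac hi₀)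
  rw [IsUnit.prod_univ_iff]
  exact fun j => (ψ.isUnit_restrict_coord _).ringInverse

theorem sum_logDeriv_mul_logJac (k : Fin m) : ∑ j, ψ.logDeriv j * ψ.logJac j k = 0 := by
  rw [← ψ.sum_restrict_pderiv_mul_jac k]
  refine Finset.sum_congr rfl fun j _ => ?_
  have h := Ring.mul_inverse_cancel _ (ψ.isUnit_restrict_coord j)
  rw [logDeriv, logJac, map_mul]
  linear_combination (ψ.restrict (pderiv j (polyGerm f z₀)) * ψ.jac j k) * h

theorem sum_mul_logJac (k : Fin m) :
    ∑ j, algebraMap ℂ (AnalyticGerm (0 : Fin m → ℂ)) (y j) * ψ.logJac j k =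
      pderiv k (phase y L ψ) := by
  rw [phase, pderiv_restrict]
  refine Finset.sum_congr rfl fun j _ => ?_
  have h := Ring.mul_inverse_cancel _ (ψ.isUnit_restrict_coord j)
  have h1 := congrArg ψ.restrict (pderiv_logForm_mul_coord y L j)
  rw [map_mul, AlgHom.commutes] at h1
  rw [← h1, logJac]
  linear_combination (ψ.restrict (pderiv j (logForm y L)) * ψ.jac j k) * h

theorem restrict_fiberEq_some (i j : Fin (m + 1)) :
    ψ.restrict (fiberEq f y z₀ (some (i, j))) =
      ψ.logDeriv i * algebraMap ℂ (AnalyticGerm (0 : Fin m → ℂ)) (y j) -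
        ψ.logDeriv j * algebraMap ℂ (AnalyticGerm (0 : Fin m → ℂ)) (y i) := by
  simp only [fiberEq, logDeriv, map_sub, map_mul, AlgHom.commutes]

theorem restrict_fiberEq_none : ψ.restrict (fiberEq f y z₀ none) = 0 :=
  ψ.restrict_polyGerm

theorem restrict_fiberEq_mem (a : Option (Fin (m + 1) × Fin (m + 1))) :
    ψ.restrict (fiberEq f y z₀ a) ∈ gradIdeal (phase y L ψ) := by
  obtain ⟨i₀, hi₀⟩ := z₀.2.2
  rcases a with _ | ⟨i, j⟩
  · rw [restrict_fiberEq_none]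
    exact zero_mem _
  · rw [restrict_fiberEq_some]
    exact minor_mem_span ψ.sum_logDeriv_mul_logJac (ψ.sum_mul_logJac y L) (ψ.isUnit_logDeriv hi₀)
      (ψ.isUnit_det_logJac hi₀) i j

theorem map_restrict_span_fiberEq :
    (Ideal.span (Set.range (fiberEq f y z₀))).map ψ.restrict = gradIdeal (phase y L ψ) := by
  refine le_antisymm ?_ ?_
  · rw [Ideal.map_span, Ideal.span_le]
    rintro _ ⟨_, ⟨a, rfl⟩, rfl⟩
    exact ψ.restrict_fiberEq_mem y L a
  · obtain ⟨i₀, hi₀⟩ := z₀.2.2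
    rw [gradIdeal, Ideal.span_le]
    rintro _ ⟨k, rfl⟩
    refine (Ideal.unit_mul_mem_iff_mem _ (ψ.isUnit_logDeriv hi₀)).1 ?_
    rw [mul_eq_sum_minor_mul ψ.sum_logDeriv_mul_logJac (ψ.sum_mul_logJac y L)]
    refine sum_mem fun j _ => Ideal.mul_mem_right _ _ ?_
    rw [← restrict_fiberEq_some]
    exact Ideal.mem_map_of_mem _ (Ideal.subset_span (Set.mem_range_self _))

theorem ker_restrict_le_span_fiberEq :
    RingHom.ker ψ.restrict ≤ Ideal.span (Set.range (fiberEq f y z₀)) :=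
  ψ.ker_restrict_le.trans (Ideal.span_mono (Set.singleton_subset_iff.2 ⟨none, rfl⟩))

theorem span_fiberEq_eq_comap :
    Ideal.span (Set.range (fiberEq f y z₀)) = (gradIdeal (phase y L ψ)).comap ψ.restrict :=
  eq_comap_of_map_eq ψ.restrict_surjective (ψ.ker_restrict_le_span_fiberEq y)
    (ψ.map_restrict_span_fiberEq y L)

/-! ### The singular locus of the fibre -/

/-- Multiplying the Jacobian matrix by `(e_{i₀} | jac)` replaces derivatives in `z` by the one along
`z_{i₀}` and those in `x`. For `g i = ∑ C_il ∂_l h` on the hypersurface, the latter are `∑ C_il ∂_k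
∂_l h` modulo the gradient ideal, which leaves `(u | C) · diag(1, Hess h)`. -/
theorem restrict_minor_mul_sub_mem {i₀ : Fin (m + 1)} {h : AnalyticGerm (0 : Fin m → ℂ)}
    (g : Fin (m + 1) → AnalyticGerm z₀.1)
    (C : Matrix (Fin (m + 1)) (Fin m) (AnalyticGerm (0 : Fin m → ℂ)))
    (hC : ∀ i, ψ.restrict (g i) = ∑ l, C i l * pderiv l h) :
    ψ.restrict (Matrix.of fun i j => pderiv j (g i)).det *
        (Matrix.of fun j => (Fin.cons (if j = i₀ then 1 else 0) (ψ.jac j) :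
          Fin (m + 1) → AnalyticGerm (0 : Fin m → ℂ))).det -
      (Matrix.of fun i => (Fin.cons (ψ.restrict (pderiv i₀ (g i))) (C i) :
          Fin (m + 1) → AnalyticGerm (0 : Fin m → ℂ))).det * hessian h ∈ gradIdeal h := by
  have hH : hessian h = (Matrix.of fun l k => pderiv k (pderiv l h)).det := by
    rw [hessian]
    congr 1
    ext1 l k
    exact pderiv_comm l k h
  rw [hH, ← det_mul_blockDiagonal, AlgHom.map_det, ← Matrix.det_mul]
  refine det_sub_det_mem _ fun i k => ?_
  rw [Matrix.mul_apply]
  refine Fin.cases ?_ (fun k => ?_) k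
  · simp
  · have h1 := ψ.pderiv_restrict (g i) k
    simp only [AlgHom.mapMatrix_apply, Matrix.map_apply, Matrix.of_apply, Fin.cons_succ]
    rw [← h1, hC, ← pderivation_apply, map_sum, ← Finset.sum_sub_distrib]
    refine sum_mem fun l _ => ?_
    rw [pderivation_apply, pderiv_mul, add_sub_cancel_left]
    exact Ideal.mul_mem_right _ _ (Ideal.subset_span (Set.mem_range_self l))

theorem isUnit_det_cons_jac {i₀ : Fin (m + 1)} (hi₀ : partialDeriv i₀ f.eval z₀.1 ≠ 0) :
    IsUnit (Matrix.of fun j => (Fin.cons (if j = i₀ then 1 else 0) (ψ.jac j) :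
      Fin (m + 1) → AnalyticGerm (0 : Fin m → ℂ))).det :=
  det_cons_single i₀ ψ.jac (ψ.isUnit_det_jac hi₀)

theorem map_restrict_singularIdeal :
    (singularIdeal (fiberEq f y z₀)).map ψ.restrict =
      gradIdeal (phase y L ψ) ⊔ Ideal.span {hessian (phase y L ψ)} := by
  obtain ⟨i₀, hi₀⟩ := z₀.2.2
  have hM := ψ.isUnit_det_cons_jac hi₀
  rw [singularIdeal, Ideal.map_sup, map_restrict_span_fiberEq ψ y L]
  refine le_antisymm (sup_le le_sup_left ?_) (sup_le le_sup_left ?_)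
  · rw [Ideal.map_span, Ideal.span_le]
    rintro _ ⟨_, ⟨r, rfl⟩, rfl⟩
    have hr : ∀ i, ∃ c : Fin m → AnalyticGerm (0 : Fin m → ℂ),
        ∑ l, c l * pderiv l (phase y L ψ) = ψ.restrict (fiberEq f y z₀ (r i)) := fun i =>
      Ideal.mem_span_range_iff_exists_fun.1 (ψ.restrict_fiberEq_mem y L (r i))
    choose c hc using hr
    have h := ψ.restrict_minor_mul_sub_mem (i₀ := i₀) (fun i => fiberEq f y z₀ (r i))
      (Matrix.of c) fun i => (hc i).symm
    refine (Ideal.mul_unit_mem_iff_mem _ hM).1 ?_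
    refine (Submodule.sub_mem_iff_left _ ?_).1 (Ideal.mem_sup_left h)
    exact Ideal.mem_sup_right (Ideal.mul_mem_left _ _ (Ideal.mem_span_singleton_self _))
  · rw [Ideal.span_le, Set.singleton_subset_iff]
    obtain ⟨C, hCu, hC⟩ := exists_matrix_minor_eq ψ.sum_logDeriv_mul_logJac (ψ.sum_mul_logJac y L)
      (ψ.isUnit_logDeriv hi₀) (ψ.isUnit_det_logJac hi₀)
    -- The equations chosen are `f` and the minors of row `i₀`. As `f` restricts to `0`, the first
    -- row of `(u | C')` is `(∂f/∂z_{i₀}, 0, …, 0)`, and its determinant is a unit.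
    let r : Fin (m + 1) → Option (Fin (m + 1) × Fin (m + 1)) :=
      Fin.cons none fun j => some (i₀, i₀.succAbove j)
    let C' : Matrix (Fin (m + 1)) (Fin m) (AnalyticGerm (0 : Fin m → ℂ)) :=
      Matrix.of (Fin.cons 0 C)
    have h := ψ.restrict_minor_mul_sub_mem (i₀ := i₀) (h := phase y L ψ)
      (fun i => fiberEq f y z₀ (r i)) C' (by
        refine Fin.cases ?_ fun j => ?_
        · exact (ψ.restrict_fiberEq_none y).trans
            (Finset.sum_eq_zero fun l _ => zero_mul (pderiv l (phase y L ψ))).symm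
        · simp only [r, Fin.cons_succ, restrict_fiberEq_some, hC]
          rfl)
    have hD : IsUnit (Matrix.of fun i => (Fin.cons (ψ.restrict (pderiv i₀ (fiberEq f y z₀ (r i))))
        (C' i) : Fin (m + 1) → AnalyticGerm (0 : Fin m → ℂ))).det := by
      rw [Matrix.det_succ_row_zero, Fin.sum_univ_succ]
      have h0 : ∀ k : Fin m, C' 0 k = 0 := fun k => rfl
      simp only [Matrix.of_apply, Fin.cons_succ, h0, mul_zero, zero_mul, Finset.sum_const_zero,
        add_zero, Fin.cons_zero, Fin.val_zero, pow_zero, one_mul]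
      refine IsUnit.mul ?_ hCu
      refine isUnit_of_evalHom_ne_zero ?_
      rw [evalHom_restrict]
      exact (evalHom_pderiv_polyGerm i₀).trans_ne hi₀
    refine (Ideal.unit_mul_mem_iff_mem _ hD).1 ?_
    refine (Submodule.sub_mem_iff_right _ ?_).1 (Ideal.mem_sup_left h)
    refine Ideal.mem_sup_right (Ideal.mul_mem_right _ _ (Ideal.mem_map_of_mem _ ?_))
    exact Ideal.subset_span (Set.mem_range_self r)

theorem singularIdeal_eq_comap :
    singularIdeal (fiberEq f y z₀) =
      (gradIdeal (phase y L ψ) ⊔ Ideal.span {hessian (phase y L ψ)}).comap ψ.restrict :=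
  eq_comap_of_map_eq ψ.restrict_surjective
    ((ψ.ker_restrict_le_span_fiberEq y).trans le_sup_left) (ψ.map_restrict_singularIdeal y L)

end LocalCoords

end Fiber

/-! ### Isolated points of the fibre -/

section Isolated

/-- Passes from ideals of germs to zero sets: a membership relation holds pointwise near `p`. -/
theorem eventually_eq_zero_of_mem_span {n r : ℕ} {p : Fin n → ℂ} (F : Fin r → AnalyticFun p)
    {g : AnalyticGerm p} {G : (Fin n → ℂ) → ℂ} (hgG : IsGermOf g G)
    (hg : g ∈ Ideal.span (Set.range fun k => AnalyticFun.germ p (F k))) :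
    ∀ᶠ x in 𝓝 p, (∀ k, (F k).1 x = 0) → G x = 0 := by
  obtain ⟨c, hc⟩ := Ideal.mem_span_range_iff_exists_fun.1 hg
  choose C _ hC using fun k => exists_isGermOf (c k)
  have h := ((isGermOf_sum Finset.univ fun k _ => (hC k).mul (isGermOf_germ (F k))).eq_iff hgG).1 hc
  filter_upwards [h] with x hx hF
  rw [← hx]
  exact Finset.sum_eq_zero fun k _ => by rw [hF, mul_zero]

theorem logGauss_eq_mk_iff {n : ℕ} (f : LaurentPoly n) (z : regularLocus f) (y : Fin n → ℂ)
    (hy : y ≠ 0) : logGauss f z = Projectivization.mk ℂ y hy ↔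
      ∀ i j, z.1 i * partialDeriv i f.eval z.1 * y j = z.1 j * partialDeriv j f.eval z.1 * y i := by
  rw [logGauss, Projectivization.mk_eq_mk_iff']
  constructor
  · rintro ⟨a, ha⟩ i j
    have h : ∀ i, z.1 i * partialDeriv i f.eval z.1 = a * y i := fun i => (congrFun ha i).symm
    rw [h, h]
    ring
  · intro h
    obtain ⟨i, hi⟩ := z.2.2
    have hw : z.1 i * partialDeriv i f.eval z.1 ≠ 0 := mul_ne_zero (z.2.1.1 i) hi
    have hyi : y i ≠ 0 := by
      intro h0
      refine hy (funext fun j => ?_)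
      have h1 := h i j
      rw [h0, mul_zero] at h1
      exact (mul_eq_zero.1 h1).resolve_left hw
    refine ⟨z.1 i * partialDeriv i f.eval z.1 / y i, funext fun j => ?_⟩
    rw [Pi.smul_apply, smul_eq_mul, div_mul_eq_mul_div, h i j, mul_div_assoc, div_self hyi, mul_one]

variable {m : ℕ} {f : LaurentPoly (m + 1)} {z₀ : regularLocus f} (ψ : LocalCoords f z₀)
  {y : Fin (m + 1) → ℂ} {hy : y ≠ 0} (L : LogBranch z₀.1)

namespace LocalCoords

/-- At a point of the fibre the minors vanish, so `0` is a critical point of the phase and the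
gradient ideal is proper. -/
theorem pderiv_phase_mem_vanishingIdeal (hγ : logGauss f z₀ = Projectivization.mk ℂ y hy)
    (k : Fin m) : pderiv k (phase y L ψ) ∈ vanishingIdeal (0 : Fin m → ℂ) := by
  obtain ⟨i₀, hi₀⟩ := z₀.2.2
  rw [logGauss_eq_mk_iff] at hγ
  refine (Ideal.unit_mul_mem_iff_mem _ (ψ.isUnit_logDeriv hi₀)).1 ?_
  rw [mul_eq_sum_minor_mul ψ.sum_logDeriv_mul_logJac (ψ.sum_mul_logJac y L)]
  refine sum_mem fun j _ => Ideal.mul_mem_right _ _ ?_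
  rw [mem_vanishingIdeal, map_sub, map_mul, map_mul, evalHom_logDeriv, evalHom_logDeriv,
    AlgHom.commutes, AlgHom.commutes]
  exact sub_eq_zero.2 (hγ i₀ j)

/-- Near `0`, critical points of the phase map to points of the fibre, because the minors lie in the
gradient ideal. An isolated fibre point is therefore an isolated critical point, and the
Nullstellensatz applies. -/
theorem vanishingIdeal_le_radical_gradIdeal
    (hiso : ∀ᶠ z in 𝓝 z₀, logGauss f z = Projectivization.mk ℂ y hy → z = z₀) :
    vanishingIdeal (0 : Fin m → ℂ) ≤ (gradIdeal (phase y L ψ)).radical := by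
  obtain ⟨i₀, hi₀⟩ := z₀.2.2
  choose G hGa hG using fun k => exists_isGermOf (pderiv k (phase y L ψ))
  let F : Fin m → AnalyticFun (0 : Fin m → ℂ) := fun k => ⟨G k, hGa k⟩
  have hF : (fun k => AnalyticFun.germ 0 (F k)) = fun k => pderiv k (phase y L ψ) := by
    funext k
    exact ((isGermOf_germ (F k)).eq_iff (hG k)).2 EventuallyEq.rfl
  have hgrad : gradIdeal (phase y L ψ) =
      Ideal.span (Set.range fun k => AnalyticFun.germ 0 (F k)) := by
    rw [hF]
    rfl
  rw [hgrad]
  refine vanishingIdeal_le_radical_span F ?_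
  have hE : ∀ᶠ x in 𝓝 (0 : Fin m → ℂ), ∀ i j, (∀ k, (F k).1 x = 0) →
      ψ.param x i * partialDeriv i f.eval (ψ.param x) * y j -
        ψ.param x j * partialDeriv j f.eval (ψ.param x) * y i = 0 := by
    refine eventually_all.2 fun i => eventually_all.2 fun j => ?_
    have hd : ∀ i, IsGermOf (coord z₀.1 i * pderiv i (polyGerm f z₀))
        fun z => z i * partialDeriv i f.eval z := fun i =>
      (isGermOf_coord i).mul ((isGermOf_germOf _).pderiv i)
    refine eventually_eq_zero_of_mem_span F (ψ.isGermOf_restrict (((hd i).mul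
      (isGermOf_algebraMap (y j))).sub ((hd j).mul (isGermOf_algebraMap (y i))))) ?_
    rw [← hgrad]
    exact ψ.restrict_fiberEq_mem y L (some (i, j))
  have hreg : ∀ᶠ x in 𝓝 (0 : Fin m → ℂ), partialDeriv i₀ f.eval (ψ.param x) ≠ 0 :=
    ψ.tendsto.eventually
      (((isGermOf_germOf (f.analyticAt_eval z₀.2.1.1)).pderiv
        i₀).analyticAt.continuousAt.eventually_ne hi₀)
  -- Isolation is given in the space of regular points; `ψ.eventually_mem` and `hreg` show that
  -- `ψ.param x` belongs to it.
  rw [nhds_subtype_eq_comap, eventually_comap] at hiso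
  filter_upwards [hE, hreg, ψ.tendsto.eventually hiso, ψ.eventually_mem,
    ψ.eventually_param_eq_imp] with x hx hxr hxi hxm hx0 hxF
  have h := hxi ⟨ψ.param x, hxm, i₀, hxr⟩ rfl
    ((logGauss_eq_mk_iff _ _ _ _).2 fun i j => sub_eq_zero.1 (hx i j hxF))
  exact hx0 (congrArg Subtype.val h)

end LocalCoords

end Isolated

/-! ### The socle of the Milnor algebra -/

theorem mem_milnorSocle_iff {n : ℕ} {p : Fin n → ℂ} {h : AnalyticGerm p} {s : AnalyticGerm p} :
    Ideal.Quotient.mk (gradIdeal h) s ∈ milnorSocle h ↔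
      ∀ a ∈ vanishingIdeal p, s * a ∈ gradIdeal h := by
  rw [milnorSocle, Submodule.mem_annihilator]
  constructor
  · intro hs a ha
    rw [← Ideal.Quotient.eq_zero_iff_mem, map_mul]
    exact hs _ (Ideal.mem_map_of_mem _ ha)
  · intro hs b hb
    obtain ⟨a, ha, rfl⟩ :=
      (Ideal.mem_map_iff_of_surjective _ Ideal.Quotient.mk_surjective).1 hb
    rw [smul_eq_mul, ← map_mul, Ideal.Quotient.eq_zero_iff_mem]
    exact hs a ha

/-- The `n` partial derivatives form a complete intersection whose Jacobian matrix is the Hessian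
matrix, up to a transposition that symmetry makes harmless. -/
theorem comap_milnorSocle {n : ℕ} {h : AnalyticGerm (0 : Fin n → ℂ)}
    (hcrit : ∀ i, pderiv i h ∈ vanishingIdeal 0) (hrad : vanishingIdeal 0 ≤ (gradIdeal h).radical) :
    (milnorSocle h).comap (Ideal.Quotient.mk (gradIdeal h)) =
      gradIdeal h ⊔ Ideal.span {hessian h} := by
  ext s
  have hH : hessian h = (Matrix.of fun i j => pderiv j (pderiv i h)).det := by
    rw [hessian]
    congr 1
    ext1 i j
    exact pderiv_comm i j h
  rw [Ideal.mem_comap, mem_milnorSocle_iff, hH]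
  exact mem_socle_iff_mem_sup_jacobian (fun i => pderiv i h) hcrit hrad s

theorem milnorSocle_eq_span_hessian {n : ℕ} {h : AnalyticGerm (0 : Fin n → ℂ)}
    (hcrit : ∀ i, pderiv i h ∈ vanishingIdeal 0) (hrad : vanishingIdeal 0 ≤ (gradIdeal h).radical) :
    milnorSocle h = Ideal.span {Ideal.Quotient.mk (gradIdeal h) (hessian h)} := by
  rw [← Ideal.map_comap_of_surjective _ Ideal.Quotient.mk_surjective (milnorSocle h),
    comap_milnorSocle hcrit hrad, Ideal.map_sup, Ideal.map_quotient_self, bot_sup_eq,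
    Ideal.map_span, Set.image_singleton]

end LogGauss

end

theorem corollary2 {m : ℕ} (f : LogGauss.LaurentPoly (m + 1)) (z₀ : LogGauss.regularLocus f)
    (y : Fin (m + 1) → ℂ) (hy : y ≠ 0)
    (hγ : LogGauss.logGauss f z₀ = Projectivization.mk ℂ y hy)
    (L : LogGauss.LogBranch z₀.1) (ψ : LogGauss.LocalCoords f z₀) :
    (∃ e : LogGauss.FiberRing f y z₀ ≃ₐ[ℂ] LogGauss.MilnorAlgebra (LogGauss.phase y L ψ),
      ∀ g : LogGauss.AnalyticGerm z₀.1,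
        e (Ideal.Quotient.mk _ g) = Ideal.Quotient.mk _ (ψ.restrict g)) ∧
    ((∀ᶠ z in nhds z₀, LogGauss.logGauss f z = Projectivization.mk ℂ y hy → z = z₀) →
      LogGauss.milnorSocle (LogGauss.phase y L ψ) =
        Ideal.span {Ideal.Quotient.mk _ (LogGauss.hessian (LogGauss.phase y L ψ))} ∧
      ∃ e : LogGauss.FiberSingRing f y z₀ ≃ₐ[ℂ]
          (LogGauss.MilnorAlgebra (LogGauss.phase y L ψ) ⧸
            LogGauss.milnorSocle (LogGauss.phase y L ψ)),
        ∀ g : LogGauss.AnalyticGerm z₀.1,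
          e (Ideal.Quotient.mk _ g) =
            Ideal.Quotient.mk _ (Ideal.Quotient.mk _ (ψ.restrict g))) := by
  refine ⟨LogGauss.exists_quotient_algEquiv ψ.restrict ψ.restrict_surjective
    (ψ.span_fiberEq_eq_comap y L), fun hiso => ?_⟩
  have hcrit := ψ.pderiv_phase_mem_vanishingIdeal L hγ
  have hrad := ψ.vanishingIdeal_le_radical_gradIdeal L hiso
  refine ⟨LogGauss.milnorSocle_eq_span_hessian hcrit hrad, ?_⟩
  refine LogGauss.exists_quotient_algEquiv
    ((Ideal.Quotient.mkₐ ℂ (LogGauss.gradIdeal (LogGauss.phase y L ψ))).comp ψ.restrict)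
    ((Ideal.Quotient.mkₐ_surjective ℂ _).comp ψ.restrict_surjective) ?_
  -- The singular ideal and the preimage of the socle agree, both being the preimage of the gradient
  -- ideal enlarged by the Hessian.
  rw [ψ.singularIdeal_eq_comap y L, ← LogGauss.comap_milnorSocle hcrit hrad]
  rfl
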